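/- **Definitions.** *Burling graphs.* For a graph $G$ and a set $\mathcal S$ of stable sets of $G$, let $\mathrm{next}(G,\mathcal S)=(G',\mathcal S')$, where $G'$ consists of a copy of $G$, one further copy $G_S$ of $G$ for each $S\in\mathcal S$ (with $\mathcal S_S$ the copy of $\mathcal S$ in $G_S$), and, for all $S\in\mathcal S$ and $Q\in\mathcal S_S$, one new vertex $v_{S,Q}$ whose neighbours are exactly the vertices of $Q$; and $\mathcal S'$ consists of all sets $S\cup Q$ and $S\cup\{v_{S,Q}\}$ with $S\in\mathcal S$ (in the first copy) and $Q\in\mathcal S_S$. Put $G_1=K_1$, $\mathcal S_1=\{V(G_1)\}$ and $(G_{k+1},\mathcal S_{k+1})=\mathrm{next}(G_k,\mathcal S_k)$. A *Burling graph* is a graph isomorphic to an induced subgraph of some $G_k$, $k\ge 1$. *Frames.* A frame is the boundary of an axis-aligned rectangle $[l,r]\times[b,t]\subset\mathbb R^2$ with $l<r$, $b<t$. A frame $A$ is *inside* a frame $B$ if $A$ is contained in the open rectangle enclosed by $B$. With $A$ bounding $[l_A,r_A]\times[b_A,t_A]$ and similarly for $B$, $A$ *enters* $B$ if $l_B<l_A<r_B<r_A$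 and $b_B<b_A<t_A<t_B$. A set $S$ of frames is *restricted* if: (i) no three distinct frames of $S$ are pairwise intersecting; (ii) no corner of a frame of $S$ lies on another frame of $S$; (iii) the left side of a frame of $S$ meets no other frame of $S$; (iv) if the right side of a frame of $S$ meets another frame of $S$, it meets both the top and the bottom side of that frame; (v) if two distinct frames of $S$ intersect, no frame of $S$ is contained in the intersection of the two closed rectangles they bound. A restricted set $S$ is *strict* if, whenever $A,B,C\in S$, $A$ is inside $B$ and $C$ intersects both $A$ and $B$, then $C$ enters both $A$ and $B$. *Boxes.* Let $S$ be a strict set of frames. A family $(I_A)_{A\in S}$ of non-empty intervals of $\mathbb R$ is *compatible* with $S$ if for all $A,B\in S$: if $A$ enters $B$ then $I_B\subsetneq I_A$; if $A$ is inside $B$ then $I_A\cap I_B=\varnothing$. The box associated to $A$ and $I_A$ is $\{(x,y,z)\in\mathbb R^3 : (x,y)\in R_A,\ z\in I_A\}$, where $R_A$ is the closed rectangle bounded by $A$. A set of boxes is *strict* if it consists of the boxes associated to the frames of some strict set of frames and the intervals of some compatible family. A *strict box graph* is a graph isomorphic to the intersection graph of a finite strict set of boxes. **Theorem 6.15 (strict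 box graphs).** The class of strict box graphs is equal to the class of Burling graphs: a graph is a strict box graph if and only if it is a Burling graph. Moreover: 1. For every finite strict set $S$ of frames there is a family of intervals compatible with $S$; it can be chosen to consist of closed bounded intervals $[a,b]$ with $a<b$. 2. For every strict set $S$ of frames, every compatible family $(I_A)_{A\in S}$ and all $A,B\in S$, the boxes associated to $A,I_A$ and to $B,I_B$ intersect if and only if the frames $A$ and $B$ intersect. -/

import Mathlib

/-- A graph together with a set of stable (independent) sets of it. -/
structure StablePair where
  V : Type
  graph : SimpleGraph V
  stables : Set (Set V)
  stable : ∀ S ∈ stables, graph.IsIndepSet S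

namespace StablePair

/-- The vertices of the graph that follows `P` in the construction: the first copy of `P.graph`,
one further copy of `P.graph` for each distinguished stable set `S`, and one new vertex `v_{S,Q}`
for each pair of distinguished stable sets `S` (of the first copy) and `Q` (of the copy attached
to `S`). -/
inductive NextVertex (P : StablePair) : Type
  | base (v : P.V) : NextVertex P
  | copy (S : P.stables) (v : P.V) : NextVertex P
  | apex (S Q : P.stables) : NextVertex P

open NextVertex

/-- Adjacency: as in `P.graph` inside each copy, and `v_{S,Q}` is complete to the set `Q` of
the copy attached to `S`. -/
def NextAdj (P : StablePair) : P.NextVertex → P.NextVertex → Prop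
  | base u, base v => P.graph.Adj u v
  | copy S u, copy S' v => S = S' ∧ P.graph.Adj u v
  | apex S Q, copy S' v => S = S' ∧ v ∈ Q.1
  | copy S' v, apex S Q => S = S' ∧ v ∈ Q.1
  | _, _ => False

/-- The graph that follows `P`. -/
def nextGraph (P : StablePair) : SimpleGraph P.NextVertex where
  Adj := P.NextAdj
  symm := ⟨by
    rintro (u | ⟨S, u⟩ | ⟨S, Q⟩) (v | ⟨S', v⟩ | ⟨S', Q'⟩) h <;> simp only [NextAdj] at h ⊢
    · exact h.symm
    · exact ⟨h.1.symm, h.2.symm⟩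
    · exact h
    · exact h⟩
  loopless := ⟨by
    rintro (u | ⟨S, u⟩ | ⟨S, Q⟩) h <;> simp [NextAdj] at h⟩

/-- The stable sets `S ∪ Q` and `S ∪ {v_{S,Q}}`, where `S` lies in the first copy and `Q` in the
copy attached to `S`. -/
def nextStables (P : StablePair) : Set (Set P.NextVertex) :=
  {X | ∃ S Q : P.stables,
    X = base '' S.1 ∪ copy S '' Q.1 ∨ X = base '' S.1 ∪ {apex S Q}}

/-- The function `(G, 𝒮) ↦ (G', 𝒮')`. -/
def next (P : StablePair) : StablePair where
  V := P.NextVertex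
  graph := P.nextGraph
  stables := P.nextStables
  stable := by
    rintro X ⟨S, Q, rfl | rfl⟩
    · rintro _ (⟨u, hu, rfl⟩ | ⟨u, hu, rfl⟩) _ (⟨v, hv, rfl⟩ | ⟨v, hv, rfl⟩) hne h
      · exact P.stable _ S.2 hu hv (fun e => hne (by rw [e])) h
      · exact h
      · exact h
      · exact P.stable _ Q.2 hu hv (fun e => hne (by rw [e])) h.2
    · rintro _ (⟨u, hu, rfl⟩ | rfl) _ (⟨v, hv, rfl⟩ | rfl) hne h
      · exact P.stable _ S.2 hu hv (fun e => hne (by rw [e])) h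
      · exact h
      · exact h
      · exact h

/-- The pair `(K₁, {V(K₁)})`. -/
def single : StablePair where
  V := Unit
  graph := ⊥
  stables := {Set.univ}
  stable := fun _ _ _ _ _ _ _ h => h

end StablePair

/-- The Burling sequence, indexed from `0`: `burlingSeq k` is the pair `(G_{k+1}, 𝒮_{k+1})`. -/
def burlingSeq : ℕ → StablePair
  | 0 => StablePair.single
  | k + 1 => (burlingSeq k).next

/-- Burling graphs: the graphs isomorphic to an induced subgraph of a graph of the
Burling sequence. -/
def IsBurlingGraph {V : Type*} (G : SimpleGraph V) : Prop :=
  ∃ k : ℕ, Nonempty (G ↪g (burlingSeq k).graph)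

/-- A frame in the plane, given by the axis-aligned rectangle `[left, right] × [bottom, top]`
(of positive width and height) that it bounds. -/
@[ext]
structure Frame where
  left : ℝ
  right : ℝ
  bottom : ℝ
  top : ℝ
  left_lt_right : left < right
  bottom_lt_top : bottom < top

namespace Frame

/-- The closed rectangle bounded by the frame. -/
def region (A : Frame) : Set (ℝ × ℝ) := Set.Icc A.left A.right ×ˢ Set.Icc A.bottom A.top

/-- The open rectangle enclosed by the frame. -/
def inner (A : Frame) : Set (ℝ × ℝ) := Set.Ioo A.left A.right ×ˢ Set.Ioo A.bottom A.top

def leftSide (A : Frame) : Set (ℝ × ℝ) := {A.left} ×ˢ Set.Icc A.bottom A.top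

def rightSide (A : Frame) : Set (ℝ × ℝ) := {A.right} ×ˢ Set.Icc A.bottom A.top

def bottomSide (A : Frame) : Set (ℝ × ℝ) := Set.Icc A.left A.right ×ˢ {A.bottom}

def topSide (A : Frame) : Set (ℝ × ℝ) := Set.Icc A.left A.right ×ˢ {A.top}

/-- The four corners of the frame. -/
def corners (A : Frame) : Set (ℝ × ℝ) :=
  {(A.left, A.bottom), (A.left, A.top), (A.right, A.bottom), (A.right, A.top)}

/-- The points of the frame itself, i.e. the boundary of the rectangle. -/
def points (A : Frame) : Set (ℝ × ℝ) := frontier A.region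

/-- The boundary of the rectangle is the union of its four sides. -/
theorem points_eq_sides (A : Frame) :
    A.points = A.leftSide ∪ A.rightSide ∪ A.bottomSide ∪ A.topSide := by
  have h1 := A.left_lt_right
  have h2 := A.bottom_lt_top
  unfold points region
  rw [frontier_prod_eq, closure_Icc, closure_Icc, frontier_Icc h1.le, frontier_Icc h2.le]
  ext ⟨x, y⟩
  simp only [leftSide, rightSide, bottomSide, topSide, Set.mem_union, Set.mem_prod,
    Set.mem_insert_iff, Set.mem_singleton_iff]
  tauto

/-- Two frames intersect (as subsets of the plane). -/
def Meets (A B : Frame) : Prop := (A.points ∩ B.points).Nonempty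

/-- `A` is entirely inside `B`. -/
def Inside (A B : Frame) : Prop := A.points ⊆ B.inner

/-- `A` enters `B`: the left side of `A` lies in the open rectangle enclosed by `B`, the right
side of `A` lies to the right of `B`, and the frames cross at exactly two points, where the right
side of `B` crosses the bottom and the top of `A`. -/
def Enters (A B : Frame) : Prop :=
  B.left < A.left ∧ A.left < B.right ∧ B.right < A.right ∧
    B.bottom < A.bottom ∧ A.top < B.top

/-- Restricted sets of frames. -/
structure IsRestricted (S : Set Frame) : Prop where
  triangle_free : ∀ A ∈ S, ∀ B ∈ S, ∀ C ∈ S, A ≠ B → B ≠ C → A ≠ C →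
    ¬ (A.Meets B ∧ B.Meets C ∧ A.Meets C)
  corners_disjoint : ∀ A ∈ S, ∀ B ∈ S, A ≠ B → Disjoint A.corners B.points
  left_disjoint : ∀ A ∈ S, ∀ B ∈ S, A ≠ B → Disjoint A.leftSide B.points
  right_crosses : ∀ A ∈ S, ∀ B ∈ S, A ≠ B → (A.rightSide ∩ B.points).Nonempty →
    (A.rightSide ∩ B.topSide).Nonempty ∧ (A.rightSide ∩ B.bottomSide).Nonempty
  not_contained : ∀ A ∈ S, ∀ B ∈ S, A ≠ B → A.Meets B →
    ∀ C ∈ S, ¬ C.points ⊆ A.region ∩ B.region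

/-- Strict sets of frames. -/
structure IsStrict (S : Set Frame) : Prop extends IsRestricted S where
  enters_both : ∀ A ∈ S, ∀ B ∈ S, A.Inside B →
    ∀ C ∈ S, C.Meets A → C.Meets B → C.Enters A ∧ C.Enters B

/-- A family of nonempty intervals of `ℝ` (bounded or not, open, closed or neither), one for each
frame of `S`, that is compatible with `S`. Values of `I` outside `S` are irrelevant. -/
structure IsCompatible (S : Set Frame) (I : Frame → Set ℝ) : Prop where
  nonempty : ∀ A ∈ S, (I A).Nonempty
  interval : ∀ A ∈ S, (I A).OrdConnected
  of_enters : ∀ A ∈ S, ∀ B ∈ S, A.Enters B → I B ⊂ I A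
  of_inside : ∀ A ∈ S, ∀ B ∈ S, A.Inside B → I A ∩ I B = ∅

/-- The axis-aligned box of `ℝ³` associated to a frame `A` and an interval `J`. -/
def box (A : Frame) (J : Set ℝ) : Set (ℝ × ℝ × ℝ) :=
  {p | (p.1, p.2.1) ∈ A.region ∧ p.2.2 ∈ J}

end Frame

/-- Strict sets of boxes: those that consist of the boxes associated to the frames of a strict
set of frames and to the intervals of a compatible family. -/
def IsStrictBoxSet (𝓑 : Set (Set (ℝ × ℝ × ℝ))) : Prop :=
  ∃ (S : Set Frame) (I : Frame → Set ℝ), Frame.IsStrict S ∧ Frame.IsCompatible S I ∧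
    𝓑 = (fun A => A.box (I A)) '' S

/-- The intersection graph of a set of sets: its vertices are the sets, and two distinct ones are
adjacent if and only if they intersect. -/
def intersectionGraph {α : Type*} (𝓑 : Set (Set α)) : SimpleGraph 𝓑 where
  Adj X Y := X ≠ Y ∧ (X.1 ∩ Y.1).Nonempty
  symm := ⟨fun X Y h => ⟨h.1.symm, by rw [Set.inter_comm]; exact h.2⟩⟩
  loopless := ⟨fun _ h => h.1 rfl⟩

/-- Strict box graphs: the graphs isomorphic to the intersection graph of a finite strict set of
boxes. -/
def IsStrictBoxGraph {V : Type*} (G : SimpleGraph V) : Prop :=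
  ∃ 𝓑 : Set (Set (ℝ × ℝ × ℝ)), 𝓑.Finite ∧ IsStrictBoxSet 𝓑 ∧
    Nonempty (G ≃g intersectionGraph 𝓑)

/-! In a restricted set two frames that meet do so in one way only: one enters the other
(`IsRestricted.enters_or_enters`). Two frames that do not meet are nested or bound disjoint
rectangles. Compatible intervals overlap in the first case and are disjoint for nested frames, so
boxes meet exactly when frames do. Intervals exist because every frame around `A` is also around
each frame that `A` enters: take `[-A.left, b]`, with `b` just below the least left end among the
intervals of the frames around `A`.

From strict frames to Burling graphs, the induction is on the number of frames. The stable sets must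
play a role, so the hypothesis is strengthened: every branch (a nested chain closed under passing to
surrounding frames) is the trace of a distinguished stable set. Remove the frame `r` whose right
side is rightmost. The frames inside `r` see none of those outside, and the frames that `r` enters
form a branch of the outer part. Hence `r` can be a new vertex `v_{S,Q}`, with `Q` tracing that
branch, and two steps of the construction put the parts together
(`IsBranchEmbedding.exists_insert`).

Conversely, each graph of the sequence is drawn with strict frames, together with a rectangle (root)
for each distinguished stable set `S` that is inside exactly the frames of `S` (`IsFrameModel`). The
next graph is obtained by drawing a shrunken copy in each root, where `v_{S,Q}` is a long frame that
starts in the shrunken root of `Q` and leaves the copy to the right (`IsFrameModel.next`).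
Strictness passes to subsets, which takes care of induced subgraphs. -/

namespace Frame

/-! ### Mutual position of two frames -/

theorem mem_points {A : Frame} {p : ℝ × ℝ} : p ∈ A.points ↔
    (A.left ≤ p.1 ∧ p.1 ≤ A.right ∧ A.bottom ≤ p.2 ∧ p.2 ≤ A.top) ∧
      (p.1 = A.left ∨ p.1 = A.right ∨ p.2 = A.bottom ∨ p.2 = A.top) := by
  have h1 := A.left_lt_right
  have h2 := A.bottom_lt_top
  rw [points_eq_sides]
  simp only [leftSide, rightSide, bottomSide, topSide, Set.mem_union, Set.mem_prod,
    Set.mem_singleton_iff, Set.mem_Icc]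
  constructor
  · rintro (((⟨h, h3, h4⟩ | ⟨h, h3, h4⟩) | ⟨⟨h3, h4⟩, h⟩) | ⟨⟨h3, h4⟩, h⟩) <;>
      simp [h, h3, h4, h1.le, h2.le]
  · tauto

theorem nonempty_points (A : Frame) : A.points.Nonempty :=
  ⟨(A.left, A.bottom), mem_points.2 ⟨⟨le_rfl, A.left_lt_right.le, le_rfl, A.bottom_lt_top.le⟩,
    Or.inl rfl⟩⟩

theorem inside_iff {A B : Frame} : A.Inside B ↔
    B.left < A.left ∧ A.right < B.right ∧ B.bottom < A.bottom ∧ A.top < B.top := by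
  have h1 := A.left_lt_right
  have h2 := A.bottom_lt_top
  constructor
  · intro h
    have p : (A.left, A.bottom) ∈ B.inner := h (mem_points.2 ⟨⟨le_rfl, h1.le, le_rfl, h2.le⟩, by simp⟩)
    have q : (A.right, A.top) ∈ B.inner := h (mem_points.2 ⟨⟨h1.le, le_rfl, h2.le, le_rfl⟩, by simp⟩)
    exact ⟨p.1.1, q.1.2, p.2.1, q.2.2⟩
  · rintro ⟨h3, h4, h5, h6⟩ p hp
    obtain ⟨⟨a, b, c, d⟩, -⟩ := mem_points.1 hp
    exact ⟨⟨by linarith, by linarith⟩, ⟨by linarith, by linarith⟩⟩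

/-- The closed rectangles bounded by the frames are disjoint. -/
def Apart (A B : Frame) : Prop :=
  A.right < B.left ∨ B.right < A.left ∨ A.top < B.bottom ∨ B.top < A.bottom

theorem Meets.symm {A B : Frame} (h : A.Meets B) : B.Meets A := by
  unfold Meets at *
  rwa [Set.inter_comm]

theorem Apart.symm {A B : Frame} (h : A.Apart B) : B.Apart A := by
  unfold Apart at *
  tauto

theorem meets_of_mem {A B : Frame} {x y : ℝ}
    (hA : A.left ≤ x ∧ x ≤ A.right ∧ A.bottom ≤ y ∧ y ≤ A.top)
    (hA' : x = A.left ∨ x = A.right ∨ y = A.bottom ∨ y = A.top)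
    (hB : B.left ≤ x ∧ x ≤ B.right ∧ B.bottom ≤ y ∧ y ≤ B.top)
    (hB' : x = B.left ∨ x = B.right ∨ y = B.bottom ∨ y = B.top) : A.Meets B :=
  ⟨(x, y), mem_points.2 ⟨hA, hA'⟩, mem_points.2 ⟨hB, hB'⟩⟩

theorem Enters.meets {A B : Frame} (h : A.Enters B) : A.Meets B := by
  obtain ⟨h1, h2, h3, h4, h5⟩ := h
  have := A.bottom_lt_top
  exact meets_of_mem (x := B.right) (y := A.bottom)
    ⟨by linarith, by linarith, by linarith, by linarith⟩ (by simp)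
    ⟨by linarith, by linarith, by linarith, by linarith⟩ (by simp)

/-- Two frames that do not intersect are nested or bound disjoint rectangles. -/
theorem nested_or_apart {A B : Frame} (h : ¬ A.Meets B) :
    A.Inside B ∨ B.Inside A ∨ A.Apart B := by
  by_contra hc
  have a1 := A.left_lt_right
  have a2 := A.bottom_lt_top
  have b1 := B.left_lt_right
  have b2 := B.bottom_lt_top
  simp only [inside_iff, Apart, not_or, not_lt] at hc
  obtain ⟨hAB, hBA, h1, h2, h3, h4⟩ := hc
  -- the corners of the intersection of the two rectangles
  have key : ∀ x y, (x = A.left ∧ B.left ≤ x ∨ x = A.right ∧ x ≤ B.right) →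
      (y = B.bottom ∧ A.bottom ≤ y ∨ y = B.top ∧ y ≤ A.top) → False := by
    rintro x y hx hy
    refine h (meets_of_mem (x := x) (y := y) ?_ (by tauto) ?_ (by tauto)) <;>
    · rcases hx with ⟨rfl, hx⟩ | ⟨rfl, hx⟩ <;> rcases hy with ⟨rfl, hy⟩ | ⟨rfl, hy⟩ <;>
        refine ⟨?_, ?_, ?_, ?_⟩ <;> linarith
  have key' : ∀ x y, (x = B.left ∧ A.left ≤ x ∨ x = B.right ∧ x ≤ A.right) →
      (y = A.bottom ∧ B.bottom ≤ y ∨ y = A.top ∧ y ≤ B.top) → False := by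
    rintro x y hx hy
    refine h (meets_of_mem (x := x) (y := y) ?_ (by tauto) ?_ (by tauto)) <;>
    · rcases hx with ⟨rfl, hx⟩ | ⟨rfl, hx⟩ <;> rcases hy with ⟨rfl, hy⟩ | ⟨rfl, hy⟩ <;>
        refine ⟨?_, ?_, ?_, ?_⟩ <;> linarith
  -- If all four sides of the overlap come from one frame only, that frame is inside the other.
  -- Otherwise a vertical and a horizontal side of the overlap come from different frames, and their
  -- common corner lies on both frames.
  grind

/-- In a restricted set, of two distinct intersecting frames one enters the other. -/
theorem IsRestricted.enters_or_enters {S : Set Frame} (hS : IsRestricted S) {A B : Frame}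
    (hA : A ∈ S) (hB : B ∈ S) (hne : A ≠ B) (h : A.Meets B) : A.Enters B ∨ B.Enters A := by
  -- If the right side of `A` meets `B`, then `B` enters `A`
  have key : ∀ A ∈ S, ∀ B ∈ S, A ≠ B → (A.rightSide ∩ B.points).Nonempty → B.Enters A := by
    intro A hA B hB hne h
    obtain ⟨⟨⟨x, y⟩, hx, hy⟩, ⟨⟨x', y'⟩, hx', hy'⟩⟩ := hS.right_crosses A hA B hB hne h
    have a2 := A.bottom_lt_top
    have a1 := A.left_lt_right
    have b2 := B.bottom_lt_top
    have b1 := B.left_lt_right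
    simp only [rightSide, topSide, bottomSide, Set.mem_prod, Set.mem_singleton_iff,
      Set.mem_Icc] at hx hy hx' hy'
    obtain ⟨rfl, h1, h2⟩ := hx
    obtain ⟨⟨h3, h4⟩, rfl⟩ := hy
    obtain ⟨rfl, h5, h6⟩ := hx'
    obtain ⟨-, rfl⟩ := hy'
    -- Condition (iv) gives weak inequalities only. Equality would put a corner or the left side of
    -- one frame on the other; and if `A` started no further left than `B` ends its own left side,
    -- `A.leftSide` would hit the top of `B`.
    have cA := Set.disjoint_left.1 (hS.corners_disjoint A hA B hB hne)
    have cB := Set.disjoint_left.1 (hS.corners_disjoint B hB A hA hne.symm)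
    have lA := Set.disjoint_left.1 (hS.left_disjoint A hA B hB hne)
    have lB := Set.disjoint_left.1 (hS.left_disjoint B hB A hA hne.symm)
    have e1 : B.left ≠ A.right := fun e =>
      @lB (B.left, B.top) ⟨rfl, b2.le, le_rfl⟩
        (mem_points.2 ⟨⟨by simp only []; linarith, e.le, by simp only []; linarith, h2⟩, by simp [e]⟩)
    have e2 : A.right ≠ B.right := fun e =>
      @cB (B.right, B.top) (by simp [corners])
        (mem_points.2 ⟨⟨by simp only []; linarith, e.ge, by simp only []; linarith, h2⟩, by simp [e]⟩)
    have e3 : A.bottom ≠ B.bottom := fun e =>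
      @cA (A.right, A.bottom) (by simp [corners])
        (mem_points.2 ⟨⟨h3, h4, e.ge, by simp only []; linarith⟩, by simp [e]⟩)
    have e4 : A.top ≠ B.top := fun e =>
      @cA (A.right, A.top) (by simp [corners])
        (mem_points.2 ⟨⟨h3, h4, by simp only []; linarith, e.le⟩, by simp [e]⟩)
    have e5 : A.left < B.left := by
      by_contra hlt
      exact @lA (A.left, B.top) ⟨rfl, by simp only []; linarith, h2⟩
        (mem_points.2 ⟨⟨by simp only []; linarith, by simp only []; linarith, b2.le, le_rfl⟩,
          by simp⟩)
    exact ⟨e5, lt_of_le_of_ne h3 e1, lt_of_le_of_ne h4 e2, lt_of_le_of_ne h5 e3,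
      lt_of_le_of_ne h2 (Ne.symm e4)⟩
  obtain ⟨p, hpA, hpB⟩ := h
  by_cases h1 : (A.rightSide ∩ B.points).Nonempty
  · exact Or.inr (key A hA B hB hne h1)
  by_cases h2 : (B.rightSide ∩ A.points).Nonempty
  · exact Or.inl (key B hB A hA hne.symm h2)
  exfalso
  have cA := Set.disjoint_left.1 (hS.corners_disjoint A hA B hB hne)
  have cB := Set.disjoint_left.1 (hS.corners_disjoint B hB A hA hne.symm)
  have lA := Set.disjoint_left.1 (hS.left_disjoint A hA B hB hne)
  have lB := Set.disjoint_left.1 (hS.left_disjoint B hB A hA hne.symm)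
  have a1 := A.left_lt_right
  have b1 := B.left_lt_right
  have a2 := A.bottom_lt_top
  have b2 := B.bottom_lt_top
  obtain ⟨x, y⟩ := p
  have hpA' := hpA
  have hpB' := hpB
  simp only [mem_points] at hpA hpB
  obtain ⟨⟨p1, p2, p3, p4⟩, p5⟩ := hpA
  obtain ⟨⟨q1, q2, q3, q4⟩, q5⟩ := hpB
  have n1 : x ≠ A.left := fun e => lA (a := (x, y)) ⟨e, p3, p4⟩ hpB'
  have n2 : x ≠ B.left := fun e => lB (a := (x, y)) ⟨e, q3, q4⟩ hpA'
  have n3 : x ≠ A.right := fun e => h1 ⟨(x, y), ⟨e, p3, p4⟩, hpB'⟩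
  have n4 : x ≠ B.right := fun e => h2 ⟨(x, y), ⟨e, q3, q4⟩, hpA'⟩
  -- the point lies on a horizontal side of both; so does the left end of one of the two
  have p6 : y = A.bottom ∨ y = A.top := by tauto
  have q6 : y = B.bottom ∨ y = B.top := by tauto
  rcases le_total A.left B.left with hl | hl
  · refine lB (a := (B.left, y)) ⟨rfl, q3, q4⟩ (mem_points.2 ⟨⟨hl, ?_, p3, p4⟩, by tauto⟩)
    simp only []; linarith
  · refine lA (a := (A.left, y)) ⟨rfl, p3, p4⟩ (mem_points.2 ⟨⟨hl, ?_, q3, q4⟩, by tauto⟩)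
    simp only []; linarith

theorem IsRestricted.meets_iff {S : Set Frame} (hS : IsRestricted S) {A B : Frame}
    (hA : A ∈ S) (hB : B ∈ S) (hne : A ≠ B) : A.Meets B ↔ A.Enters B ∨ B.Enters A :=
  ⟨hS.enters_or_enters hA hB hne, fun h => h.elim Enters.meets fun h => h.meets.symm⟩

theorem IsRestricted.mono {S T : Set Frame} (hS : IsRestricted S) (h : T ⊆ S) :
    IsRestricted T where
  triangle_free A hA B hB C hC := hS.triangle_free A (h hA) B (h hB) C (h hC)
  corners_disjoint A hA B hB := hS.corners_disjoint A (h hA) B (h hB)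
  left_disjoint A hA B hB := hS.left_disjoint A (h hA) B (h hB)
  right_crosses A hA B hB := hS.right_crosses A (h hA) B (h hB)
  not_contained A hA B hB h1 h2 C hC := hS.not_contained A (h hA) B (h hB) h1 h2 C (h hC)

theorem IsStrict.mono {S T : Set Frame} (hS : IsStrict S) (h : T ⊆ S) : IsStrict T where
  toIsRestricted := hS.toIsRestricted.mono h
  enters_both A hA B hB h1 C hC := hS.enters_both A (h hA) B (h hB) h1 C (h hC)

theorem Inside.trans {A B C : Frame} (h : A.Inside B) (h' : B.Inside C) : A.Inside C := by
  rw [inside_iff] at *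
  obtain ⟨_, _, _, _⟩ := h
  obtain ⟨_, _, _, _⟩ := h'
  refine ⟨?_, ?_, ?_, ?_⟩ <;> linarith

theorem Inside.irrefl {A : Frame} (h : A.Inside A) : False := by
  rw [inside_iff] at h
  linarith [h.1]

theorem Enters.irrefl {A : Frame} (h : A.Enters A) : False := by
  have := h.1
  linarith

theorem not_enters_self (A : Frame) : ¬ A.Enters A := fun h => h.irrefl

section Strict
variable {S : Set Frame} {A B C : Frame}

/-- The frames that a given one enters are nested. -/
theorem IsRestricted.nested_of_enters (hS : IsRestricted S) (hA : A ∈ S) (hB : B ∈ S)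
    (hC : C ∈ S) (hne : B ≠ C) (h : A.Enters B) (h' : A.Enters C) : B.Inside C ∨ C.Inside B := by
  have hm : ¬ B.Meets C := fun hm =>
    hS.triangle_free A hA B hB C hC (fun e => (e ▸ h).irrefl) hne (fun e => (e ▸ h').irrefl)
      ⟨h.meets, hm, h'.meets⟩
  rcases nested_or_apart hm with h1 | h1 | h1
  · exact Or.inl h1
  · exact Or.inr h1
  · obtain ⟨_, _, _, _, _⟩ := h
    obtain ⟨_, _, _, _, _⟩ := h'
    have := A.bottom_lt_top
    rcases h1 with h1 | h1 | h1 | h1 <;> exfalso <;> linarith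

/-- If `B` met `C`, strictness applied to `A` inside `C` would make `B` enter `A`, against `B.left <
A.left`. So `B` and `C` do not meet, their rectangles overlap, and `C` cannot be inside `B` because
`A` reaches beyond `B` on the right. -/
theorem IsStrict.inside_of_enters_of_inside (hS : IsStrict S) (hA : A ∈ S) (hB : B ∈ S)
    (hC : C ∈ S) (h : A.Enters B) (h' : A.Inside C) : B.Inside C := by
  have hi := inside_iff.1 h'
  obtain ⟨i1, i2, i3, i4⟩ := hi
  have hBA : ¬ B.Enters A := fun hh => by
    have := h.1
    have := hh.1
    linarith
  have hm : ¬ B.Meets C := fun hm =>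
    hBA (hS.enters_both A hA C hC h' B hB h.meets.symm hm).1
  obtain ⟨e1, e2, e3, e4, e5⟩ := h
  have := A.bottom_lt_top
  have := A.left_lt_right
  rcases nested_or_apart hm with h1 | h1 | h1
  · exact h1
  · obtain ⟨_, _, _, _⟩ := inside_iff.1 h1
    linarith
  · rcases h1 with h1 | h1 | h1 | h1 <;> exfalso <;> linarith

/-- If `A` meets `C`, strictness applies to `B` inside `C`. Otherwise the rectangles overlap within
`B`, and `C` inside `A` is excluded since `C.left < B.left < A.left`. -/
theorem IsStrict.enters_or_inside (hS : IsStrict S) (hA : A ∈ S) (hB : B ∈ S)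
    (hC : C ∈ S) (h : A.Enters B) (h' : B.Inside C) : A.Enters C ∨ A.Inside C := by
  have hne : A ≠ C := by
    rintro rfl
    have := h.1
    have := (inside_iff.1 h').1
    linarith
  by_cases hm : A.Meets C
  · exact Or.inl (hS.enters_both B hB C hC h' A hA h.meets hm).2
  obtain ⟨e1, e2, e3, e4, e5⟩ := h
  obtain ⟨i1, i2, i3, i4⟩ := inside_iff.1 h'
  have := A.bottom_lt_top
  have := A.left_lt_right
  rcases nested_or_apart hm with h1 | h1 | h1
  · exact Or.inr h1
  · obtain ⟨_, _, _, _⟩ := inside_iff.1 h1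
    linarith
  · rcases h1 with h1 | h1 | h1 | h1 <;> exfalso <;> linarith

end Strict

/-! ### Boxes and compatible intervals -/

/-- The boxes of a compatible family intersect exactly when their frames do. -/
theorem IsCompatible.box_inter_nonempty_iff {S : Set Frame} {I : Frame → Set ℝ}
    (hS : IsRestricted S) (hI : IsCompatible S I) {A B : Frame} (hA : A ∈ S) (hB : B ∈ S) :
    (A.box (I A) ∩ B.box (I B)).Nonempty ↔ A.Meets B := by
  constructor
  · rintro ⟨⟨x, y, z⟩, ⟨⟨⟨h1, h2⟩, h3, h4⟩, hz⟩, ⟨⟨h5, h6⟩, h7, h8⟩, hz'⟩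
    by_contra hm
    rcases nested_or_apart hm with h | h | h
    · have := hI.of_inside A hA B hB h
      exact this.subset ⟨hz, hz'⟩
    · have := hI.of_inside B hB A hA h
      exact this.subset ⟨hz', hz⟩
    · rcases h with h | h | h | h <;> linarith
  · rintro ⟨⟨x, y⟩, hp, hp'⟩
    have hp1 := (mem_points.1 hp).1
    have hp2 := (mem_points.1 hp').1
    have : (I A ∩ I B).Nonempty := by
      rcases eq_or_ne A B with rfl | hne
      · simpa using hI.nonempty A hA
      · rcases hS.enters_or_enters hA hB hne ⟨(x, y), hp, hp'⟩ with h | h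
        · obtain ⟨z, hz⟩ := hI.nonempty B hB
          exact ⟨z, (hI.of_enters A hA B hB h).1 hz, hz⟩
        · obtain ⟨z, hz⟩ := hI.nonempty A hA
          exact ⟨z, hz, (hI.of_enters B hB A hA h).1 hz⟩
    obtain ⟨z, hz, hz'⟩ := this
    exact ⟨(x, y, z), ⟨⟨⟨hp1.1, hp1.2.1⟩, hp1.2.2⟩, hz⟩, ⟨⟨⟨hp2.1, hp2.2.1⟩, hp2.2.2⟩, hz'⟩⟩

/-- Nonempty boxes determine their frames. -/
theorem eq_of_box_eq {A B : Frame} {I J : Set ℝ} (hI : I.Nonempty) (hJ : J.Nonempty)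
    (h : A.box I = B.box J) : A = B := by
  have key : ∀ {A B : Frame} {I J : Set ℝ}, I.Nonempty → A.box I = B.box J →
      B.left ≤ A.left ∧ A.right ≤ B.right ∧ B.bottom ≤ A.bottom ∧ A.top ≤ B.top := by
    rintro A B I J ⟨z, hz⟩ h
    have a1 := A.left_lt_right.le
    have a2 := A.bottom_lt_top.le
    have p : (A.left, A.bottom, z) ∈ B.box J := h ▸ ⟨⟨⟨le_rfl, a1⟩, ⟨le_rfl, a2⟩⟩, hz⟩
    have q : (A.right, A.top, z) ∈ B.box J := h ▸ ⟨⟨⟨a1, le_rfl⟩, ⟨a2, le_rfl⟩⟩, hz⟩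
    exact ⟨p.1.1.1, q.1.1.2, p.1.2.1, q.1.2.2⟩
  obtain ⟨h1, h2, h3, h4⟩ := key hI h
  obtain ⟨k1, k2, k3, k4⟩ := key hJ h.symm
  exact Frame.ext (by linarith) (by linarith) (by linarith) (by linarith)

/-- A finite strict set of frames has a compatible family of closed bounded intervals. -/
theorem IsStrict.exists_isCompatible {S : Set Frame} (hfin : S.Finite) (hS : IsStrict S) :
    ∃ I : Frame → Set ℝ, IsCompatible S I ∧ ∀ A ∈ S, ∃ a b : ℝ, a < b ∧ I A = Set.Icc a b := by
  classical
  -- all differences of left ends are at least `ε`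
  obtain ⟨ε, hε, hgap⟩ : ∃ ε : ℝ, 0 < ε ∧
      ∀ A ∈ S, ∀ B ∈ S, B.left < A.left → B.left + ε < A.left := by
    have hpairs : ((S ×ˢ S) ∩ {p | p.2.left < p.1.left}).Finite := (hfin.prod hfin).inter_of_left _
    have : ∀ᶠ ε : ℝ in nhdsWithin 0 (Set.Ioi 0), ∀ p ∈ (S ×ˢ S) ∩ {p : Frame × Frame |
        p.2.left < p.1.left}, p.2.left + ε < p.1.left := by
      rw [Filter.eventually_all_finite hpairs]
      rintro ⟨A, B⟩ ⟨-, h⟩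
      have h : 0 < A.left - B.left := sub_pos.2 h
      filter_upwards [Ioo_mem_nhdsGT h] with ε hε
      have := hε.2
      linarith
    obtain ⟨ε, h1, h2⟩ := (this.and self_mem_nhdsWithin).exists
    exact ⟨ε, h2, fun A hA B hB h => h1 (A, B) ⟨⟨hA, hB⟩, h⟩⟩
  obtain ⟨M, hM⟩ : ∃ M : ℝ, ∀ A ∈ S, - A.left + ε < M := by
    obtain ⟨M, hM⟩ := (hfin.image fun A : Frame => - A.left + ε).bddAbove
    exact ⟨M + 1, fun A hA => by linarith [hM ⟨A, hA, rfl⟩]⟩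
  -- The interval of `A` starts at `-A.left` and must end before `-B.left` for every `B` around `A`.
  -- The margin `ε / 2` makes the intervals disjoint, and the gap `ε` keeps each of them
  -- nondegenerate. The bound `M` serves the frames that are inside no other.
  let T : Frame → Finset ℝ := fun A =>
    insert M ((hfin.toFinset.filter fun B => A.Inside B).image fun B => - B.left - ε / 2)
  have hT : ∀ A, (T A).Nonempty := fun A => Finset.insert_nonempty _ _
  let b : Frame → ℝ := fun A => (T A).min' (hT A)
  have hmem : ∀ A, ∀ B ∈ S, A.Inside B → b A ≤ - B.left - ε / 2 := fun A B hB h =>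
    Finset.min'_le _ _ (Finset.mem_insert_of_mem
      (Finset.mem_image.2 ⟨B, by simp [hB, h], rfl⟩))
  have hb : ∀ A ∈ S, - A.left < b A := by
    intro A hA
    refine (Finset.lt_min'_iff _ _).2 fun y hy => ?_
    rcases Finset.mem_insert.1 hy with rfl | hy
    · linarith [hM A hA]
    · obtain ⟨B, hB, rfl⟩ := Finset.mem_image.1 hy
      simp only [Finset.mem_filter, Set.Finite.mem_toFinset] at hB
      linarith [hgap A hA B hB.1 (inside_iff.1 hB.2).1]
  refine ⟨fun A => Set.Icc (- A.left) (b A), ⟨fun A hA => Set.nonempty_Icc.2 (hb A hA).le,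
    fun A _ => Set.ordConnected_Icc, ?_, ?_⟩, fun A hA => ⟨_, _, hb A hA, rfl⟩⟩
  · intro A hA B hB h
    have hlt : - A.left < - B.left := neg_lt_neg h.1
    -- Every frame around `A` is around `B` too, so `b B` is a minimum over a larger set.
    have hle : b B ≤ b A := by
      refine Finset.le_min' _ _ _ fun y hy => ?_
      rcases Finset.mem_insert.1 hy with rfl | hy
      · exact Finset.min'_le _ _ (Finset.mem_insert_self _ _)
      · obtain ⟨C, hC, rfl⟩ := Finset.mem_image.1 hy
        simp only [Finset.mem_filter, Set.Finite.mem_toFinset] at hC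
        exact hmem B C hC.1 (hS.inside_of_enters_of_inside hA hB hC.1 h hC.2)
    refine Set.ssubset_iff_subset_ne.2 ⟨Set.Icc_subset_Icc hlt.le hle, fun e => ?_⟩
    have : - A.left ∈ Set.Icc (- B.left) (b B) := e ▸ Set.left_mem_Icc.2 (hb A hA).le
    linarith [this.1]
  · intro A hA B hB h
    ext z
    simp only [Set.mem_inter_iff, Set.mem_Icc, Set.mem_empty_iff_false, iff_false]
    rintro ⟨⟨-, h1⟩, h2, -⟩
    linarith [hmem A B hB h]

end Frame

/-! ### Vertices and stable sets of the next pair -/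

namespace StablePair
variable {P : StablePair}

/-- A vertex of the first copy in `P.next`. -/
def baseV (v : P.V) : P.next.V := NextVertex.base v

/-- A vertex of the copy attached to `S` in `P.next`. -/
def copyV (S : P.stables) (v : P.V) : P.next.V := NextVertex.copy S v

/-- The new vertex attached to `S` and `Q` in `P.next`. -/
def apexV (S Q : P.stables) : P.next.V := NextVertex.apex S Q

theorem next_cases {p : P.next.V → Prop} (base : ∀ v, p (baseV v)) (copy : ∀ S v, p (copyV S v))
    (apex : ∀ S Q, p (apexV S Q)) (x : P.next.V) : p x :=
  match x with
  | NextVertex.base v => base v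
  | NextVertex.copy S v => copy S v
  | NextVertex.apex S Q => apex S Q

section Vertices
variable {u v : P.V} {S S' Q Q' : P.stables}

@[simp] theorem baseV_inj : (baseV u : P.next.V) = baseV v ↔ u = v :=
  ⟨NextVertex.base.inj, fun h => by rw [h]⟩

@[simp] theorem copyV_inj : copyV S u = copyV S' v ↔ S = S' ∧ u = v :=
  ⟨fun h => by injection h with h1 h2; exact ⟨h1, h2⟩, fun h => by rw [h.1, h.2]⟩

@[simp] theorem apexV_inj : apexV S Q = apexV S' Q' ↔ S = S' ∧ Q = Q' :=
  ⟨fun h => by injection h with h1 h2; exact ⟨h1, h2⟩, fun h => by rw [h.1, h.2]⟩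

@[simp] theorem baseV_ne_copyV : (baseV u : P.next.V) ≠ copyV S v := fun h => nomatch h
@[simp] theorem copyV_ne_baseV : copyV S v ≠ (baseV u : P.next.V) := fun h => nomatch h
@[simp] theorem baseV_ne_apexV : (baseV u : P.next.V) ≠ apexV S Q := fun h => nomatch h
@[simp] theorem apexV_ne_baseV : apexV S Q ≠ (baseV u : P.next.V) := fun h => nomatch h
@[simp] theorem copyV_ne_apexV : copyV S' u ≠ apexV S Q := fun h => nomatch h
@[simp] theorem apexV_ne_copyV : apexV S Q ≠ copyV S' u := fun h => nomatch h

@[simp] theorem next_adj_base_base :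
    P.next.graph.Adj (baseV u) (baseV v) ↔ P.graph.Adj u v := Iff.rfl

@[simp] theorem next_adj_base_copy : ¬ P.next.graph.Adj (baseV u) (copyV S v) := id
@[simp] theorem next_adj_copy_base : ¬ P.next.graph.Adj (copyV S v) (baseV u) := id
@[simp] theorem next_adj_base_apex : ¬ P.next.graph.Adj (baseV u) (apexV S Q) := id
@[simp] theorem next_adj_apex_base : ¬ P.next.graph.Adj (apexV S Q) (baseV u) := id
@[simp] theorem next_adj_apex_apex : ¬ P.next.graph.Adj (apexV S Q) (apexV S' Q') := id

@[simp] theorem next_adj_copy_copy :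
    P.next.graph.Adj (copyV S u) (copyV S' v) ↔ S = S' ∧ P.graph.Adj u v := Iff.rfl

@[simp] theorem next_adj_apex_copy :
    P.next.graph.Adj (apexV S Q) (copyV S' v) ↔ S = S' ∧ v ∈ Q.1 := Iff.rfl

@[simp] theorem next_adj_copy_apex :
    P.next.graph.Adj (copyV S' v) (apexV S Q) ↔ S = S' ∧ v ∈ Q.1 := Iff.rfl

end Vertices

/-- The stable set `S ∪ Q` of `P.next`. -/
def copyStable (S Q : P.stables) : P.next.stables :=
  ⟨NextVertex.base '' S.1 ∪ NextVertex.copy S '' Q.1, S, Q, Or.inl rfl⟩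

/-- The stable set `S ∪ {v_{S,Q}}` of `P.next`. -/
def apexStable (S Q : P.stables) : P.next.stables :=
  ⟨NextVertex.base '' S.1 ∪ {NextVertex.apex S Q}, S, Q, Or.inr rfl⟩

theorem eq_copyStable_or_apexStable (X : P.next.stables) :
    ∃ S Q, X = copyStable S Q ∨ X = apexStable S Q := by
  obtain ⟨X, S, Q, rfl | rfl⟩ := X
  exacts [⟨S, Q, Or.inl rfl⟩, ⟨S, Q, Or.inr rfl⟩]

theorem mem_copyStable {S Q : P.stables} {x : P.next.V} : x ∈ (copyStable S Q).1 ↔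
    (∃ u, u ∈ S.1 ∧ baseV u = x) ∨ ∃ u, u ∈ Q.1 ∧ copyV S u = x := Iff.rfl

theorem mem_apexStable {S Q : P.stables} {x : P.next.V} : x ∈ (apexStable S Q).1 ↔
    (∃ u, u ∈ S.1 ∧ baseV u = x) ∨ x = apexV S Q := Iff.rfl

section Stables
variable {v : P.V} {S S' S'' Q Q' : P.stables}

@[simp] theorem baseV_mem_copyStable : baseV v ∈ (copyStable S Q).1 ↔ v ∈ S.1 := by
  simp [mem_copyStable]

@[simp] theorem copyV_mem_copyStable : copyV S' v ∈ (copyStable S Q).1 ↔ S = S' ∧ v ∈ Q.1 := by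
  simp only [mem_copyStable, baseV_ne_copyV, copyV_inj]
  grind

@[simp] theorem apexV_notMem_copyStable : apexV S' Q' ∉ (copyStable S Q).1 := by
  simp [mem_copyStable]

@[simp] theorem baseV_mem_apexStable : baseV v ∈ (apexStable S Q).1 ↔ v ∈ S.1 := by
  simp [mem_apexStable]

@[simp] theorem copyV_notMem_apexStable : copyV S' v ∉ (apexStable S Q).1 := by
  simp [mem_apexStable]

@[simp] theorem apexV_mem_apexStable :
    apexV S' Q' ∈ (apexStable S Q).1 ↔ S' = S ∧ Q' = Q := by
  simp [mem_apexStable]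

theorem copyStable_ne_apexStable : copyStable S Q ≠ apexStable S' Q' := fun h =>
  apexV_notMem_copyStable (h ▸ apexV_mem_apexStable.2 ⟨rfl, rfl⟩ :
    apexV S' Q' ∈ (copyStable S Q).1)

end Stables

end StablePair

theorem burlingSeq_stables_nonempty : ∀ k, (burlingSeq k).stables.Nonempty
  | 0 => ⟨Set.univ, rfl⟩
  | k + 1 => by
    obtain ⟨S, hS⟩ := burlingSeq_stables_nonempty k
    exact ⟨_, (StablePair.copyStable (P := burlingSeq k) ⟨S, hS⟩ ⟨S, hS⟩).2⟩

/-! ### Strict sets of frames embed in the Burling sequence -/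

open StablePair

/-- A chain of nested frames of `X` that contains every frame of `X` around one of its members. -/
structure IsBranch (X C : Set Frame) : Prop where
  subset : C ⊆ X
  upward : ∀ A ∈ C, ∀ B ∈ X, A.Inside B → B ∈ C
  nested : ∀ A ∈ C, ∀ B ∈ C, A ≠ B → A.Inside B ∨ B.Inside A

/-- An embedding of the intersection graph of a set of frames in the graph of `P` for which every
branch is the trace of a distinguished stable set. -/
structure IsBranchEmbedding (P : StablePair) (X : Set Frame) (φ : Frame → P.V) : Prop where
  injOn : Set.InjOn φ X
  adj : ∀ A ∈ X, ∀ B ∈ X, P.graph.Adj (φ A) (φ B) ↔ A.Enters B ∨ B.Enters A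
  trace : ∀ C, IsBranch X C → ∃ S ∈ P.stables, ∀ A ∈ X, φ A ∈ S ↔ A ∈ C

/-- The first copy suffices: there `S ∪ Q` has trace `S`, whatever `Q` is. -/
theorem IsBranchEmbedding.next {P : StablePair} {X : Set Frame} {φ : Frame → P.V}
    (h : IsBranchEmbedding P X φ) :
    IsBranchEmbedding P.next X fun A => baseV (φ A) where
  injOn A hA B hB e := h.injOn hA hB (baseV_inj.1 e)
  adj A hA B hB := h.adj A hA B hB
  trace C hC := by
    obtain ⟨S, hS, hSC⟩ := h.trace C hC
    refine ⟨_, (copyStable ⟨S, hS⟩ ⟨S, hS⟩).2, fun A hA => ?_⟩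
    simp [← hSC A hA]

theorem IsBranchEmbedding.exists_of_le {X : Set Frame} {k l : ℕ} (hkl : k ≤ l)
    {φ : Frame → (burlingSeq k).V} (h : IsBranchEmbedding (burlingSeq k) X φ) :
    ∃ ψ, IsBranchEmbedding (burlingSeq l) X ψ := by
  induction l, hkl using Nat.le_induction with
  | base => exact ⟨φ, h⟩
  | succ l _ ih =>
    obtain ⟨ψ, hψ⟩ := ih
    exact ⟨_, hψ.next⟩

/-- Adding to the frames of `Y` a frame `r`, whose neighbours form a branch of `Y`, together with
frames inside `r`. -/
theorem IsBranchEmbedding.exists_insert {P : StablePair} {Y Z : Set Frame} {r : Frame}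
    {φ ψ : Frame → P.V} (hP : P.stables.Nonempty)
    (hφ : IsBranchEmbedding P Y φ) (hψ : IsBranchEmbedding P Z ψ)
    (hr : IsBranch Y {B ∈ Y | r.Enters B})
    (hZr : ∀ A ∈ Z, A.Inside r) (hYr : ∀ A ∈ Y, A ≠ r ∧ ¬ A.Inside r ∧ ¬ r.Inside A ∧ ¬ A.Enters r)
    (hYZ : ∀ A ∈ Y, ∀ B ∈ Z, ¬ A.Enters B ∧ ¬ B.Enters A) :
    ∃ χ, IsBranchEmbedding P.next.next (Y ∪ insert r Z) χ := by
  classical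
  obtain ⟨S₀, hS₀⟩ := hP
  obtain ⟨Q, hQ, hQr⟩ := hφ.trace _ hr
  let S : P.stables := ⟨S₀, hS₀⟩
  let R : P.next.stables := apexStable S ⟨Q, hQ⟩
  have hψ' := hψ.next
  have hZne : ∀ A ∈ Z, A ≠ r := fun A hA e => (e ▸ hZr A hA).irrefl
  have hZY : ∀ A ∈ Z, A ∉ Y := fun A hA hY => (hYr A hY).2.1 (hZr A hA)
  have hrZ : r ∉ Z := fun h => hZne r h rfl
  have hrY : r ∉ Y := fun h => (hYr r h).1 rfl
  have hrZe : ∀ A ∈ Z, ¬ A.Enters r ∧ ¬ r.Enters A := by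
    intro A hA
    have := Frame.inside_iff.1 (hZr A hA)
    refine ⟨fun h => ?_, fun h => ?_⟩
    · linarith [h.2.2.1]
    · linarith [h.1]
  -- In the first step `Y` goes to the copy attached to `S` and `r` to `v_{S,Q}`. All this lies in
  -- the first copy of the second step, where `Z` goes to the copy attached to `R = S ∪ {v_{S,Q}}`.
  -- The first copy of the first step carries no frame of `Y`, so the choice of `S` is immaterial.
  let χ : Frame → P.next.next.V := fun A =>
    if A ∈ Y then baseV (copyV S (φ A))
    else if A ∈ Z then copyV R (baseV (ψ A))
    else baseV (apexV S ⟨Q, hQ⟩)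
  have χY : ∀ A ∈ Y, χ A = baseV (copyV S (φ A)) :=
    fun A hA => if_pos hA
  have χZ : ∀ A ∈ Z, χ A = copyV R (baseV (ψ A)) :=
    fun A hA => by simp only [χ, if_neg (hZY A hA), if_pos hA]
  have χr : χ r = baseV (apexV S ⟨Q, hQ⟩) := by
    simp only [χ, if_neg hrY, if_neg hrZ]
  refine ⟨χ, ?_, ?_, ?_⟩
  · rintro A (hA | hA | hA) B (hB | hB | hB) e
    · exact hφ.injOn hA hB (by simpa [χY A hA, χY B hB] using e)
    · exact absurd e (by simp [χY A hA, hB, χr])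
    · exact absurd e (by simp [χY A hA, χZ B hB])
    · exact absurd e (by simp [hA, χr, χY B hB])
    · rw [hA, hB]
    · exact absurd e (by simp [hA, χr, χZ B hB])
    · exact absurd e (by simp [χZ A hA, χY B hB])
    · exact absurd e (by simp [χZ A hA, hB, χr])
    · exact hψ.injOn hA hB (by simpa [χZ A hA, χZ B hB] using e)
  · rintro A (hA | rfl | hA) B (hB | rfl | hB)
    · rw [χY A hA, χY B hB, ← hφ.adj A hA B hB]
      simp
    · rw [χY A hA, χr]
      have := hYr A hA
      have := hQr A hA
      simp_all
    · rw [χY A hA, χZ B hB]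
      have := hYZ A hA B hB
      simp_all
    · rw [χY B hB, χr]
      have := hYr B hB
      have := hQr B hB
      simp_all
    · rw [χr]
      simp [Frame.not_enters_self]
    · rw [χr, χZ B hB]
      have := hrZe B hB
      simp_all
    · rw [χZ A hA, χY B hB]
      have := hYZ B hB A hA
      simp_all
    · rw [χr, χZ A hA]
      have := hrZe A hA
      simp_all
    · rw [χZ A hA, χZ B hB, ← hψ.adj A hA B hB]
      simp
  · intro C hC
    by_cases hrC : r ∈ C
    · have hCY : ∀ A ∈ Y, A ∉ C := fun A hA hAC =>
        (hC.nested A hAC r hrC (hYr A hA).1).elim (hYr A hA).2.1 (hYr A hA).2.2.1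
      obtain ⟨T, hT, hTC⟩ := hψ'.trace (C ∩ Z)
        ⟨Set.inter_subset_right, fun A hA B hB h => ⟨hC.upward A hA.1 B (by simp [hB]) h, hB⟩,
          fun A hA B hB => hC.nested A hA.1 B hB.1⟩
      refine ⟨_, (copyStable R ⟨T, hT⟩).2, ?_⟩
      rintro A (hA | rfl | hA)
      · rw [χY A hA]
        have := hCY A hA
        simp_all [R]
      · rw [χr]
        simp_all [R]
      · rw [χZ A hA]
        have := hTC A hA
        simp_all
    -- A branch that avoids `r` is a branch of `Y`, traced by `R' = S ∪ T`. Since `R' ≠ R`,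
    -- completing it in the copy attached to `R'` catches nothing of `Z`.
    · have hCZ : ∀ A ∈ Z, A ∉ C := fun A hA hAC =>
        hrC (hC.upward A hAC r (by simp) (hZr A hA))
      have hCsub : C ⊆ Y := by
        intro A hA
        rcases hC.subset hA with h | rfl | h
        · exact h
        · exact absurd hA hrC
        · exact absurd hA (hCZ A h)
      obtain ⟨T, hT, hTC⟩ := hφ.trace C
        ⟨hCsub, fun A hA B hB h => hC.upward A hA B (Or.inl hB) h, hC.nested⟩
      let R' : P.next.stables := copyStable S ⟨T, hT⟩
      have hne : R' ≠ R := copyStable_ne_apexStable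
      refine ⟨_, (copyStable R' R').2, ?_⟩
      rintro A (hA | rfl | hA)
      · rw [χY A hA]
        have := hTC A hA
        simp_all [R']
      · rw [χr]
        simp_all [R']
      · rw [χZ A hA]
        have := hCZ A hA
        simp_all

theorem Frame.IsStrict.exists_isBranchEmbedding {X : Set Frame} (hfin : X.Finite)
    (hX : Frame.IsStrict X) : ∃ k φ, IsBranchEmbedding (burlingSeq k) X φ := by
  induction hn : X.ncard using Nat.strong_induction_on generalizing X with
  | _ n ih =>
  rcases X.eq_empty_or_nonempty with rfl | hne
  · exact ⟨0, fun _ => (), Set.injOn_empty _, fun _ h => h.elim,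
      fun C hC => ⟨Set.univ, rfl, fun _ h => h.elim⟩⟩
  -- With its right side rightmost, `r` is inside no frame and no frame enters it.
  obtain ⟨r, hr, hmax⟩ := hfin.exists_maximalFor Frame.right X hne
  replace hmax : ∀ A ∈ X, A.right ≤ r.right := fun A hA => by
    rcases le_total A.right r.right with h | h
    · exact h
    · exact hmax hA h
  let Y : Set Frame := {A ∈ X | A ≠ r ∧ ¬ A.Inside r}
  let Z : Set Frame := {A ∈ X | A.Inside r}
  have hY : Y ⊆ X := Set.sep_subset _ _
  have hZ : Z ⊆ X := Set.sep_subset _ _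
  have hlt : ∀ W ⊆ X, r ∉ W → W.ncard < n := fun W hW hrW =>
    hn ▸ Set.ncard_lt_ncard (Set.ssubset_iff_subset_ne.2 ⟨hW, fun e => hrW (e ▸ hr)⟩) hfin
  obtain ⟨k, φ, hφ⟩ := ih _ (hlt Y hY fun h => h.2.1 rfl) (hfin.subset hY) (hX.mono hY) rfl
  obtain ⟨l, ψ, hψ⟩ := ih _ (hlt Z hZ fun h => h.2.irrefl) (hfin.subset hZ) (hX.mono hZ) rfl
  obtain ⟨φ, hφ⟩ := hφ.exists_of_le (le_max_left k l)
  obtain ⟨ψ, hψ⟩ := hψ.exists_of_le (le_max_right k l)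
  have hnin : ∀ A ∈ X, ¬ r.Inside A := fun A hA h => by
    linarith [hmax A hA, (Frame.inside_iff.1 h).2.1]
  have hnent : ∀ A ∈ X, ¬ A.Enters r := fun A hA h => by
    linarith [hmax A hA, h.2.2.1]
  obtain ⟨χ, hχ⟩ := hφ.exists_insert (r := r) (burlingSeq_stables_nonempty _) hψ
    ⟨Set.sep_subset _ _, fun A hA B hB h => ⟨hB,
        (hX.enters_or_inside hr (hY hA.1) (hY hB) hA.2 h).resolve_right (hnin B (hY hB))⟩,
      fun A hA B hB hne => hX.nested_of_enters hr (hY hA.1) (hY hB.1) hne hA.2 hB.2⟩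
    (fun A hA => hA.2) (fun A hA => ⟨hA.2.1, hA.2.2, hnin A hA.1, hnent A hA.1⟩)
    -- A frame entering one inside `r` would enter `r` or be inside it; a frame entered by one
    -- inside `r` is itself inside `r`.
    (fun A hA B hB => ⟨fun h => (hX.enters_or_inside hA.1 hB.1 hr h hB.2).elim (hnent A hA.1)
      hA.2.2, fun h => hA.2.2 (hX.inside_of_enters_of_inside hB.1 hA.1 hr h hB.2)⟩)
  have hXe : Y ∪ insert r Z = X := by
    ext A
    simp only [Y, Z, Set.mem_union, Set.mem_insert_iff, Set.mem_ofPred_eq]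
    constructor
    · rintro (h | rfl | h)
      exacts [h.1, hr, h.1]
    · intro h
      tauto
  exact ⟨max k l + 2, χ, hXe ▸ hχ⟩

/-! ### A criterion for strictness -/

namespace Frame

/-- Two frames that are nested or bound disjoint rectangles. -/
def NestedOrApart (A B : Frame) : Prop := A.Inside B ∨ B.Inside A ∨ A.Apart B

theorem NestedOrApart.symm {A B : Frame} (h : A.NestedOrApart B) : B.NestedOrApart A := by
  rcases h with h | h | h
  exacts [Or.inr (Or.inl h), Or.inl h, Or.inr (Or.inr h.symm)]

theorem NestedOrApart.not_meets {A B : Frame} (h : A.NestedOrApart B) : ¬ A.Meets B := by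
  rintro ⟨p, hA, hB⟩
  rw [mem_points] at hA hB
  obtain ⟨⟨a1, a2, a3, a4⟩, a5⟩ := hA
  obtain ⟨⟨b1, b2, b3, b4⟩, b5⟩ := hB
  rcases h with h | h | h
  · obtain ⟨_, _, _, _⟩ := inside_iff.1 h
    rcases b5 with e | e | e | e <;> linarith
  · obtain ⟨_, _, _, _⟩ := inside_iff.1 h
    rcases a5 with e | e | e | e <;> linarith
  · rcases h with h | h | h | h <;> linarith

theorem NestedOrApart.not_enters {A B : Frame} (h : A.NestedOrApart B) : ¬ A.Enters B :=
  fun h' => h.not_meets h'.meets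

theorem Apart.not_inside {A B : Frame} (h : A.Apart B) : ¬ A.Inside B := by
  intro h'
  obtain ⟨_, _, _, _⟩ := inside_iff.1 h'
  have := A.left_lt_right
  have := A.bottom_lt_top
  rcases h with h | h | h | h <;> linarith

theorem Inside.asymm {A B : Frame} (h : A.Inside B) : ¬ B.Inside A :=
  fun h' => (h.trans h').irrefl

theorem Enters.not_inside {A B : Frame} (h : A.Enters B) : ¬ A.Inside B :=
  fun h' => NestedOrApart.not_enters (Or.inl h') h

theorem Enters.not_inside' {A B : Frame} (h : A.Enters B) : ¬ B.Inside A :=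
  fun h' => NestedOrApart.not_enters (Or.inr (Or.inl h')) h

theorem corners_subset_points (A : Frame) : A.corners ⊆ A.points := by
  have h1 := A.left_lt_right.le
  have h2 := A.bottom_lt_top.le
  rintro p (rfl | rfl | rfl | rfl) <;> simp [mem_points, h1, h2]

theorem leftSide_subset_points (A : Frame) : A.leftSide ⊆ A.points := by
  rw [points_eq_sides]
  intro p hp
  simp [hp]

theorem rightSide_subset_points (A : Frame) : A.rightSide ⊆ A.points := by
  rw [points_eq_sides]
  intro p hp
  simp [hp]

theorem Enters.disjoint_corners {A B : Frame} (h : A.Enters B) : Disjoint A.corners B.points := by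
  obtain ⟨h1, h2, h3, h4, h5⟩ := h
  have := A.bottom_lt_top
  rw [Set.disjoint_left]
  rintro p (rfl | rfl | rfl | rfl) hp <;>
    · obtain ⟨⟨_, _, _, _⟩, e | e | e | e⟩ := mem_points.1 hp <;> simp only at * <;> linarith

theorem Enters.disjoint_corners' {A B : Frame} (h : A.Enters B) : Disjoint B.corners A.points := by
  obtain ⟨h1, h2, h3, h4, h5⟩ := h
  have := A.bottom_lt_top
  rw [Set.disjoint_left]
  rintro p (rfl | rfl | rfl | rfl) hp <;>
    · obtain ⟨⟨_, _, _, _⟩, -⟩ := mem_points.1 hp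
      simp only at *
      linarith

theorem Enters.disjoint_leftSide {A B : Frame} (h : A.Enters B) :
    Disjoint A.leftSide B.points := by
  obtain ⟨h1, h2, h3, h4, h5⟩ := h
  rw [Set.disjoint_left]
  rintro p ⟨e, h6, h7⟩ hp
  rw [Set.mem_singleton_iff] at e
  obtain ⟨-, e' | e' | e' | e'⟩ := mem_points.1 hp <;> linarith

theorem Enters.disjoint_leftSide' {A B : Frame} (h : A.Enters B) :
    Disjoint B.leftSide A.points := by
  obtain ⟨h1, h2, h3, h4, h5⟩ := h
  rw [Set.disjoint_left]
  rintro p ⟨e, h6, h7⟩ hp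
  rw [Set.mem_singleton_iff] at e
  obtain ⟨⟨_, _, _, _⟩, -⟩ := mem_points.1 hp
  linarith

theorem Enters.rightSide_inter {A B : Frame} (h : A.Enters B) :
    ¬ (A.rightSide ∩ B.points).Nonempty := by
  obtain ⟨h1, h2, h3, h4, h5⟩ := h
  rintro ⟨p, ⟨e, h6, h7⟩, hp⟩
  rw [Set.mem_singleton_iff] at e
  obtain ⟨⟨_, _, _, _⟩, -⟩ := mem_points.1 hp
  linarith

theorem Enters.rightSide_inter' {A B : Frame} (h : A.Enters B) :
    (B.rightSide ∩ A.topSide).Nonempty ∧ (B.rightSide ∩ A.bottomSide).Nonempty := by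
  obtain ⟨h1, h2, h3, h4, h5⟩ := h
  have := A.bottom_lt_top
  exact ⟨⟨(B.right, A.top), ⟨rfl, by constructor <;> simp only <;> linarith⟩,
      ⟨by constructor <;> simp only <;> linarith, rfl⟩⟩,
    ⟨(B.right, A.bottom), ⟨rfl, by constructor <;> simp only <;> linarith⟩,
      ⟨by constructor <;> simp only <;> linarith, rfl⟩⟩⟩

theorem le_of_points_subset_region {A B : Frame} (h : A.points ⊆ B.region) :
    B.left ≤ A.left ∧ A.right ≤ B.right ∧ B.bottom ≤ A.bottom ∧ A.top ≤ B.top := by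
  have h1 := A.left_lt_right.le
  have h2 := A.bottom_lt_top.le
  have p : (A.left, A.bottom) ∈ B.region := h (mem_points.2 (by simp [h1, h2]))
  have q : (A.right, A.top) ∈ B.region := h (mem_points.2 (by simp [h1, h2]))
  exact ⟨p.1.1, q.1.2, p.2.1, q.2.2⟩

theorem inside_of_points_subset_region {A B : Frame}
    (hAB : A.Enters B ∨ B.Enters A ∨ A.NestedOrApart B) (h : A.points ⊆ B.region) :
    A.Inside B := by
  obtain ⟨h1, h2, h3, h4⟩ := le_of_points_subset_region h
  have := A.left_lt_right
  have := A.bottom_lt_top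
  rcases hAB with h | h | h | h | h
  · linarith [h.2.2.1]
  · linarith [h.1]
  · exact h
  · linarith [(inside_iff.1 h).1]
  · rcases h with h | h | h | h <;> linarith

/-- A criterion for a family of frames to be strict. -/
theorem isStrict_range {V : Type*} {G : SimpleGraph V} {F : V → Frame}
    (adj : ∀ u v, G.Adj u v → (F u).Enters (F v) ∨ (F v).Enters (F u))
    (nonadj : ∀ u v, u ≠ v → ¬ G.Adj u v → (F u).NestedOrApart (F v))
    (triangle_free : ∀ u v w, G.Adj u v → G.Adj v w → ¬ G.Adj u w)
    (not_contained : ∀ u v w, G.Adj u v → (F w).Inside (F u) → ¬ (F w).Inside (F v))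
    (enters_both : ∀ u v w, (F u).Inside (F v) → G.Adj w u → G.Adj w v →
      (F w).Enters (F u) ∧ (F w).Enters (F v)) : IsStrict (Set.range F) := by
  have hne : ∀ {u v}, F u ≠ F v → u ≠ v := fun h e => h (e ▸ rfl)
  have hadj : ∀ {u v}, F u ≠ F v → (F u).Meets (F v) → G.Adj u v := fun h hm => by
    by_contra hn
    exact (nonadj _ _ (hne h) hn).not_meets hm
  have hrel : ∀ u v, F u ≠ F v →
      (F u).Enters (F v) ∨ (F v).Enters (F u) ∨ (F u).NestedOrApart (F v) := by
    intro u v h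
    by_cases h' : G.Adj u v
    · rcases adj u v h' with h | h
      exacts [Or.inl h, Or.inr (Or.inl h)]
    · exact Or.inr (Or.inr (nonadj u v (hne h) h'))
  have hdisj : ∀ {A B : Frame}, A.NestedOrApart B → Disjoint A.points B.points := fun h =>
    Set.disjoint_iff_inter_eq_empty.2 (Set.not_nonempty_iff_eq_empty.1 h.not_meets)
  refine ⟨⟨?_, ?_, ?_, ?_, ?_⟩, ?_⟩
  · rintro _ ⟨u, rfl⟩ _ ⟨v, rfl⟩ _ ⟨w, rfl⟩ h1 h2 h3 ⟨m1, m2, m3⟩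
    exact triangle_free u v w (hadj h1 m1) (hadj h2 m2) (hadj h3 m3)
  · rintro _ ⟨u, rfl⟩ _ ⟨v, rfl⟩ hn
    rcases hrel u v hn with h | h | h
    exacts [h.disjoint_corners, h.disjoint_corners',
      (hdisj h).mono_left (corners_subset_points _)]
  · rintro _ ⟨u, rfl⟩ _ ⟨v, rfl⟩ hn
    rcases hrel u v hn with h | h | h
    exacts [h.disjoint_leftSide, h.disjoint_leftSide',
      (hdisj h).mono_left (leftSide_subset_points _)]
  · rintro _ ⟨u, rfl⟩ _ ⟨v, rfl⟩ hn hm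
    rcases hrel u v hn with h | h | h
    · exact absurd hm h.rightSide_inter
    · exact h.rightSide_inter'
    · exact absurd (hm.mono (Set.inter_subset_inter_left _ (rightSide_subset_points _)))
        h.not_meets
  · rintro _ ⟨u, rfl⟩ _ ⟨v, rfl⟩ hn hm _ ⟨w, rfl⟩ hsub
    have h1 := hsub.trans Set.inter_subset_left
    have h2 := hsub.trans Set.inter_subset_right
    have huv := hadj hn hm
    by_cases e1 : F w = F u
    · rw [e1] at h2
      have := inside_of_points_subset_region (hrel u v hn) h2
      exact NestedOrApart.not_meets (Or.inl this) hm
    by_cases e2 : F w = F v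
    · rw [e2] at h1
      have := inside_of_points_subset_region (hrel v u hn.symm) h1
      exact NestedOrApart.not_meets (Or.inr (Or.inl this)) hm
    exact not_contained u v w huv (inside_of_points_subset_region (hrel w u e1) h1)
      (inside_of_points_subset_region (hrel w v e2) h2)
  · rintro _ ⟨u, rfl⟩ _ ⟨v, rfl⟩ hi _ ⟨w, rfl⟩ m1 m2
    by_cases e1 : F w = F u
    · rw [e1] at m2
      exact absurd m2 (NestedOrApart.not_meets (Or.inl hi))
    by_cases e2 : F w = F v
    · rw [e2] at m1
      exact absurd m1 (NestedOrApart.not_meets (Or.inr (Or.inl hi)))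
    exact enters_both u v w hi (hadj e1 m1) (hadj e2 m2)

/-! ### Affine copies and the frames added in one step -/

/-- The image of `A` under the affine map that takes `[0, 3] × [0, 1]` to the rectangle
of `R`. -/
noncomputable def place (R A : Frame) : Frame where
  left := R.left + (R.right - R.left) / 3 * A.left
  right := R.left + (R.right - R.left) / 3 * A.right
  bottom := R.bottom + (R.top - R.bottom) * A.bottom
  top := R.bottom + (R.top - R.bottom) * A.top
  left_lt_right := by
    have := sub_pos.2 R.left_lt_right
    have := A.left_lt_right
    gcongr
  bottom_lt_top := by
    have := sub_pos.2 R.bottom_lt_top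
    have := A.bottom_lt_top
    gcongr

section Place
variable {R A B : Frame}

/-- Inside, enters, apart and avoids are all stated by strict inequalities between coordinates, so
increasing affine maps on each axis preserve them. -/
theorem place_x_lt {x y : ℝ} :
    R.left + (R.right - R.left) / 3 * x < R.left + (R.right - R.left) / 3 * y ↔ x < y := by
  have := sub_pos.2 R.left_lt_right
  rw [add_lt_add_iff_left, mul_lt_mul_iff_right₀ (by positivity)]

theorem place_y_lt {x y : ℝ} :
    R.bottom + (R.top - R.bottom) * x < R.bottom + (R.top - R.bottom) * y ↔ x < y := by
  rw [add_lt_add_iff_left, mul_lt_mul_iff_right₀ (sub_pos.2 R.bottom_lt_top)]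

theorem place_inside_place : (R.place A).Inside (R.place B) ↔ A.Inside B := by
  simp only [inside_iff, place, place_x_lt, place_y_lt]

theorem place_enters_place : (R.place A).Enters (R.place B) ↔ A.Enters B := by
  simp only [Enters, place, place_x_lt, place_y_lt]

theorem place_apart_place : (R.place A).Apart (R.place B) ↔ A.Apart B := by
  simp only [Apart, place, place_x_lt, place_y_lt]

theorem place_nestedOrApart_place :
    (R.place A).NestedOrApart (R.place B) ↔ A.NestedOrApart B := by
  simp only [NestedOrApart, place_inside_place, place_apart_place]

theorem place_inside (h1 : 0 < A.left) (h2 : A.right < 3) (h3 : 0 < A.bottom) (h4 : A.top < 1) :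
    (R.place A).Inside R := by
  have hw := sub_pos.2 R.left_lt_right
  have hh := sub_pos.2 R.bottom_lt_top
  simp only [inside_iff, place]
  refine ⟨?_, ?_, ?_, ?_⟩
  · have : 0 < (R.right - R.left) / 3 * A.left := by positivity
    linarith
  · have : (R.right - R.left) / 3 * A.right < (R.right - R.left) / 3 * 3 := by gcongr
    linarith
  · have : 0 < (R.top - R.bottom) * A.bottom := by positivity
    linarith
  · have : (R.top - R.bottom) * A.top < (R.top - R.bottom) * 1 := by gcongr
    linarith

end Place

end Frame

namespace Frame

/-- The frame lies in the open unit square. -/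
structure InUnit (A : Frame) : Prop where
  left_pos : 0 < A.left
  right_lt : A.right < 1
  bottom_pos : 0 < A.bottom
  top_lt : A.top < 1

theorem InUnit.of_inside {A B : Frame} (hB : B.InUnit) (h : A.Inside B) : A.InUnit := by
  obtain ⟨h1, h2, h3, h4⟩ := hB
  obtain ⟨_, _, _, _⟩ := inside_iff.1 h
  constructor <;> linarith

theorem InUnit.place_inside {A R : Frame} (hA : A.InUnit) : (R.place A).Inside R :=
  Frame.place_inside hA.left_pos (by linarith [hA.right_lt]) hA.bottom_pos hA.top_lt

/-- The rectangle of `A` does not meet the strip that extends the rectangle of `R` to the right. -/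
def Avoids (A R : Frame) : Prop := A.right < R.left ∨ A.top < R.bottom ∨ R.top < A.bottom

theorem Avoids.mono {A R R' : Frame} (h : A.Avoids R) (hR : R'.Inside R) : A.Avoids R' := by
  obtain ⟨_, _, _, _⟩ := inside_iff.1 hR
  unfold Avoids at *
  rcases h with h | h | h
  · exact Or.inl (by linarith)
  · exact Or.inr (Or.inl (by linarith))
  · exact Or.inr (Or.inr (by linarith))

theorem Avoids.apart {A R : Frame} (h : A.Avoids R) : A.Apart R := by
  unfold Avoids at h
  unfold Apart
  tauto

theorem place_avoids_place {A B R : Frame} : (R.place A).Avoids (R.place B) ↔ A.Avoids B := by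
  simp only [Avoids, place, place_x_lt, place_y_lt]

/-- The vertical ranges of the two frames are disjoint. -/
def VerticallyApart (A B : Frame) : Prop := A.top < B.bottom ∨ B.top < A.bottom

theorem VerticallyApart.mono {A A' B B' : Frame} (h : A.VerticallyApart B) (hA : A'.Inside A)
    (hB : B'.Inside B) : A'.VerticallyApart B' := by
  obtain ⟨_, _, _, _⟩ := inside_iff.1 hA
  obtain ⟨_, _, _, _⟩ := inside_iff.1 hB
  rcases h with h | h
  · exact Or.inl (by linarith)
  · exact Or.inr (by linarith)

theorem VerticallyApart.apart {A B : Frame} (h : A.VerticallyApart B) : A.Apart B :=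
  Or.inr (Or.inr h)

theorem VerticallyApart.avoids {A B : Frame} (h : A.VerticallyApart B) : A.Avoids B :=
  Or.inr h

theorem place_verticallyApart_place {A B R : Frame} :
    (R.place A).VerticallyApart (R.place B) ↔ A.VerticallyApart B := by
  simp only [VerticallyApart, place, place_y_lt]

/-- The frame that enters the frames around the root `A` and ends outside the unit square. -/
noncomputable def longFrame (A : Frame) : Frame where
  left := A.left
  -- For `A` in the unit square this lies between 2 and 3: beyond the outer root, which ends at 3/2,
  -- yet within the domain scaled by `place`. The vertical range from 1/3 to 5/6 leaves room below
  -- for the lower root and surrounds that of the outer root.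
  right := A.right + 2
  bottom := A.bottom + (A.top - A.bottom) / 3
  top := A.bottom + (A.top - A.bottom) * (5 / 6)
  left_lt_right := by linarith [A.left_lt_right]
  bottom_lt_top := by linarith [A.bottom_lt_top]

/-- The part of the rectangle of `A` below `longFrame A`. -/
noncomputable def lowerRoot (A : Frame) : Frame where
  left := A.left
  right := A.right
  bottom := A.bottom + (A.top - A.bottom) / 9
  top := A.bottom + (A.top - A.bottom) / 6
  left_lt_right := A.left_lt_right
  bottom_lt_top := by linarith [A.bottom_lt_top]

/-- A rectangle inside `longFrame A` and to the right of the unit square. -/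
noncomputable def outerRoot (A : Frame) : Frame where
  left := 1
  right := 3 / 2
  bottom := A.bottom + (A.top - A.bottom) / 2
  top := A.bottom + (A.top - A.bottom) * (2 / 3)
  left_lt_right := by norm_num
  bottom_lt_top := by linarith [A.bottom_lt_top]

section LongFrame
variable {A B R : Frame}

theorem place_longFrame_inside (hA : A.InUnit) : (R.place A.longFrame).Inside R := by
  obtain ⟨h1, h2, h3, h4⟩ := hA
  have := A.bottom_lt_top
  apply place_inside <;> simp only [longFrame] <;> linarith

theorem place_lowerRoot_inside (hA : A.InUnit) : (R.place A.lowerRoot).Inside R := by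
  obtain ⟨h1, h2, h3, h4⟩ := hA
  have := A.bottom_lt_top
  apply place_inside <;> simp only [lowerRoot] <;> linarith

theorem place_outerRoot_inside (hA : A.InUnit) : (R.place A.outerRoot).Inside R := by
  obtain ⟨h1, h2, h3, h4⟩ := hA
  have := A.bottom_lt_top
  apply place_inside <;> simp only [outerRoot] <;> linarith

theorem longFrame_enters (hB : B.InUnit) (hA : A.InUnit) (h : A.Inside B) :
    A.longFrame.Enters B := by
  obtain ⟨_, _, _, _⟩ := inside_iff.1 h
  obtain ⟨_, _, _, _⟩ := hB
  obtain ⟨_, _, _, _⟩ := hA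
  have := A.bottom_lt_top
  have := A.left_lt_right
  simp only [Enters, longFrame]
  refine ⟨?_, ?_, ?_, ?_, ?_⟩ <;> linarith

theorem Avoids.apart_longFrame (h : B.Avoids A) : B.Apart A.longFrame := by
  have := A.bottom_lt_top
  simp only [Apart, longFrame]
  rcases h with h | h | h
  · exact Or.inl h
  · exact Or.inr (Or.inr (Or.inl (by linarith)))
  · exact Or.inr (Or.inr (Or.inr (by linarith)))

theorem lowerRoot_inside (h : A.Inside B) : A.lowerRoot.Inside B := by
  have := A.bottom_lt_top
  simp only [inside_iff, lowerRoot] at *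
  obtain ⟨_, _, _, _⟩ := h
  refine ⟨?_, ?_, ?_, ?_⟩ <;> linarith

theorem Avoids.lowerRoot (h : B.Avoids A) : B.Avoids A.lowerRoot := by
  have := A.bottom_lt_top
  simp only [Avoids, Frame.lowerRoot] at *
  rcases h with h | h | h
  · exact Or.inl h
  · exact Or.inr (Or.inl (by linarith))
  · exact Or.inr (Or.inr (by linarith))

theorem outerRoot_inside_longFrame (hA : A.InUnit) : A.outerRoot.Inside A.longFrame := by
  have := A.bottom_lt_top
  have := A.left_lt_right
  simp only [inside_iff, outerRoot, longFrame]
  obtain ⟨_, _, _, _⟩ := hA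
  refine ⟨?_, ?_, ?_, ?_⟩ <;> linarith

theorem InUnit.avoids_outerRoot (hB : B.InUnit) : B.Avoids A.outerRoot := Or.inl hB.right_lt

theorem longFrame_verticallyApart_lowerRoot : A.longFrame.VerticallyApart A.lowerRoot := by
  have := A.bottom_lt_top
  simp only [VerticallyApart, lowerRoot, longFrame]
  right
  linarith

theorem lowerRoot_verticallyApart_outerRoot : A.lowerRoot.VerticallyApart A.outerRoot := by
  have := A.bottom_lt_top
  simp only [VerticallyApart, lowerRoot, outerRoot]
  left
  linarith

theorem VerticallyApart.symm (h : A.VerticallyApart B) : B.VerticallyApart A := h.elim Or.inr Or.inl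

/-- The vertical range of `A` lies in that of `B`. -/
def VerticallyWithin (A B : Frame) : Prop := B.bottom ≤ A.bottom ∧ A.top ≤ B.top

theorem VerticallyApart.mono_within {A' B' : Frame} (h : A.VerticallyApart B)
    (hA : A'.VerticallyWithin A) (hB : B'.VerticallyWithin B) : A'.VerticallyApart B' := by
  obtain ⟨_, _⟩ := hA
  obtain ⟨_, _⟩ := hB
  rcases h with h | h
  · exact Or.inl (by linarith)
  · exact Or.inr (by linarith)

theorem longFrame_within : A.longFrame.VerticallyWithin A := by
  have := A.bottom_lt_top
  constructor <;> simp only [longFrame] <;> linarith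

theorem lowerRoot_within : A.lowerRoot.VerticallyWithin A := by
  have := A.bottom_lt_top
  constructor <;> simp only [lowerRoot] <;> linarith

theorem outerRoot_within : A.outerRoot.VerticallyWithin A := by
  have := A.bottom_lt_top
  constructor <;> simp only [outerRoot] <;> linarith

end LongFrame

end Frame

/-! ### Drawing the Burling sequence with frames -/

open Frame StablePair

/-- A representation of `P.graph` as the intersection graph of a strict family of frames in the
unit square, with a rectangle for each distinguished stable set `S` that is inside exactly the
frames of `S`, while the other frames avoid the strip to the right of it. -/
structure IsFrameModel (P : StablePair) (F : P.V → Frame) (R : P.stables → Frame) : Prop where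
  inUnit : ∀ v, (F v).InUnit
  root_inUnit : ∀ S, (R S).InUnit
  root_inside : ∀ S v, v ∈ S.1 → (R S).Inside (F v)
  avoids : ∀ S v, v ∉ S.1 → (F v).Avoids (R S)
  root_apart : ∀ S S', S ≠ S' → (R S).VerticallyApart (R S')
  adj : ∀ u v, P.graph.Adj u v → (F u).Enters (F v) ∨ (F v).Enters (F u)
  nonadj : ∀ u v, u ≠ v → ¬ P.graph.Adj u v → (F u).NestedOrApart (F v)
  triangle_free : ∀ u v w, P.graph.Adj u v → P.graph.Adj v w → ¬ P.graph.Adj u w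
  not_contained : ∀ u v w, P.graph.Adj u v → (F w).Inside (F u) → ¬ (F w).Inside (F v)
  enters_both : ∀ u v w, (F u).Inside (F v) → P.graph.Adj w u → P.graph.Adj w v →
    (F w).Enters (F u) ∧ (F w).Enters (F v)

namespace StablePair
variable {P : StablePair}

/-- The frames that represent the vertices of `P.next`. -/
noncomputable def nextFrame (F : P.V → Frame) (R : P.stables → Frame) : P.next.V → Frame
  | NextVertex.base v => F v
  | NextVertex.copy S v => (R S).place (F v)
  | NextVertex.apex S Q => (R S).place (R Q).longFrame

/-- The stable set `S ∪ Q` or `S ∪ {v_{S,Q}}` of `P.next`. -/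
def nextStable : P.stables × P.stables × Bool → P.next.stables
  | (S, Q, false) => copyStable S Q
  | (S, Q, true) => apexStable S Q

theorem nextStable_surjective : Function.Surjective (nextStable (P := P)) := fun X => by
  obtain ⟨S, Q, h | h⟩ := eq_copyStable_or_apexStable X
  exacts [⟨(S, Q, false), h.symm⟩, ⟨(S, Q, true), h.symm⟩]

/-- The rectangle that represents the stable set `S ∪ Q` or `S ∪ {v_{S,Q}}` of `P.next`. -/
noncomputable def nextRoot (R : P.stables → Frame) : P.stables × P.stables × Bool → Frame
  | (S, Q, false) => (R S).place (R Q).lowerRoot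
  | (S, Q, true) => (R S).place (R Q).outerRoot

end StablePair

namespace IsFrameModel
variable {P : StablePair} {F : P.V → Frame} {R : P.stables → Frame}

/-- A frame that avoids the root bounds a rectangle disjoint from it. So whatever is drawn in the
root of `S` sees membership in `S` as being inside. -/
theorem inside_of_inside (h : IsFrameModel P F R) {S : P.stables} {v : P.V} {A : Frame}
    (hA : A.Inside (R S)) : v ∈ S.1 ↔ A.Inside (F v) := by
  refine ⟨fun hv => hA.trans (h.root_inside S v hv), fun hi => ?_⟩
  by_contra hv
  exact ((h.avoids S v hv).mono hA).apart.symm.not_inside hi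

theorem nestedOrApart_of_inside (h : IsFrameModel P F R) {S : P.stables} {A : Frame}
    (hA : A.Inside (R S)) (v : P.V) : (F v).NestedOrApart A := by
  by_cases hv : v ∈ S.1
  · exact Or.inr (Or.inl ((h.inside_of_inside hA).1 hv))
  · exact Or.inr (Or.inr ((h.avoids S v hv).mono hA).apart)

theorem not_inside_of_inside (h : IsFrameModel P F R) {S : P.stables} {A : Frame}
    (hA : A.Inside (R S)) (v : P.V) : ¬ (F v).Inside A := by
  intro hi
  by_cases hv : v ∈ S.1
  · exact ((h.inside_of_inside hA).1 hv).asymm hi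
  · exact ((h.avoids S v hv).mono hA).apart.not_inside hi

theorem root_ne (h : IsFrameModel P F R) {S S' : P.stables} {A B : Frame} (hne : S ≠ S')
    (hA : A.Inside (R S)) (hB : B.Inside (R S')) : A.VerticallyApart B :=
  (h.root_apart S S' hne).mono hA hB

theorem copy_inside (h : IsFrameModel P F R) (S : P.stables) (v : P.V) :
    ((R S).place (F v)).Inside (R S) := (h.inUnit v).place_inside

theorem apex_inside (h : IsFrameModel P F R) (S Q : P.stables) :
    ((R S).place (R Q).longFrame).Inside (R S) := place_longFrame_inside (h.root_inUnit Q)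

theorem nextRoot_inside (h : IsFrameModel P F R) (S Q : P.stables) (b : Bool) :
    (nextRoot R (S, Q, b)).Inside (R S) := by
  cases b
  exacts [place_lowerRoot_inside (h.root_inUnit Q), place_outerRoot_inside (h.root_inUnit Q)]

theorem nextRoot_inside_nextFrame (h : IsFrameModel P F R) (i : P.stables × P.stables × Bool)
    (x : P.next.V) (hx : x ∈ (nextStable i).1) : (nextRoot R i).Inside (nextFrame F R x) := by
  obtain ⟨S, Q, b⟩ := i
  induction x using next_cases with
  | base v =>
    have hv : v ∈ S.1 := by cases b <;> simpa [nextStable] using hx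
    exact (h.inside_of_inside (h.nextRoot_inside S Q b)).1 hv
  | copy S' v =>
    cases b with
    | false =>
      obtain ⟨rfl, hv⟩ := copyV_mem_copyStable.1 hx
      exact place_inside_place.2 (lowerRoot_inside (h.root_inside Q v hv))
    | true => exact absurd hx copyV_notMem_apexStable
  | apex S' Q' =>
    cases b with
    | false => exact absurd hx apexV_notMem_copyStable
    | true =>
      obtain ⟨rfl, rfl⟩ := apexV_mem_apexStable.1 hx
      exact place_inside_place.2 (outerRoot_inside_longFrame (h.root_inUnit Q'))

/-- Drawings in different roots are vertically apart. Within one root, the lower root inherits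
avoidance from the root of `Q` and lies below the long frame; the outer root is to the right of all
copied frames. -/
theorem nextFrame_avoids_nextRoot (h : IsFrameModel P F R) (i : P.stables × P.stables × Bool)
    (x : P.next.V) (hx : x ∉ (nextStable i).1) : (nextFrame F R x).Avoids (nextRoot R i) := by
  obtain ⟨S, Q, b⟩ := i
  induction x using next_cases with
  | base v =>
    have hv : v ∉ S.1 := by cases b <;> simpa [nextStable] using hx
    exact (h.avoids S v hv).mono (h.nextRoot_inside S Q b)
  | copy S' v =>
    by_cases hS : S' = S
    · subst hS
      cases b with
      | false =>
        have hv : v ∉ Q.1 := fun hv => hx (copyV_mem_copyStable.2 ⟨rfl, hv⟩)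
        exact place_avoids_place.2 (h.avoids Q v hv).lowerRoot
      | true => exact place_avoids_place.2 (h.inUnit v).avoids_outerRoot
    · exact (h.root_ne hS (h.copy_inside S' v) (h.nextRoot_inside S Q b)).avoids
  | apex S' Q' =>
    by_cases hS : S' = S
    · subst hS
      by_cases hQ : Q' = Q
      · subst hQ
        cases b with
        | false =>
          exact (place_verticallyApart_place.2 longFrame_verticallyApart_lowerRoot).avoids
        | true => exact absurd (apexV_mem_apexStable.2 ⟨rfl, rfl⟩) hx
      · have := h.root_apart Q' Q hQ
        cases b with
        | false => exact (place_verticallyApart_place.2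
            (this.mono_within longFrame_within lowerRoot_within)).avoids
        | true => exact (place_verticallyApart_place.2
            (this.mono_within longFrame_within outerRoot_within)).avoids
    · exact (h.root_ne hS (h.apex_inside S' Q') (h.nextRoot_inside S Q b)).avoids

theorem nextRoot_apart (h : IsFrameModel P F R) {i j : P.stables × P.stables × Bool}
    (hij : i ≠ j) : (nextRoot R i).VerticallyApart (nextRoot R j) := by
  obtain ⟨S, Q, b⟩ := i
  obtain ⟨S', Q', b'⟩ := j
  by_cases hS : S = S'
  · subst hS
    by_cases hQ : Q = Q'
    · subst hQ
      cases b <;> cases b'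
      · exact absurd rfl hij
      · exact place_verticallyApart_place.2 lowerRoot_verticallyApart_outerRoot
      · exact place_verticallyApart_place.2 lowerRoot_verticallyApart_outerRoot.symm
      · exact absurd rfl hij
    · have := h.root_apart Q Q' hQ
      cases b <;> cases b' <;> refine place_verticallyApart_place.2 (this.mono_within ?_ ?_) <;>
        first | exact lowerRoot_within | exact outerRoot_within
  · exact h.root_ne hS (h.nextRoot_inside S Q b) (h.nextRoot_inside S' Q' b')

theorem nextFrame_inUnit (h : IsFrameModel P F R) (x : P.next.V) : (nextFrame F R x).InUnit := by
  induction x using next_cases with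
  | base v => exact h.inUnit v
  | copy S v => exact (h.root_inUnit S).of_inside (h.copy_inside S v)
  | apex S Q => exact (h.root_inUnit S).of_inside (h.apex_inside S Q)

theorem apex_enters_copy (h : IsFrameModel P F R) (S : P.stables) {Q : P.stables} {v : P.V}
    (hv : v ∈ Q.1) : (nextFrame F R (apexV S Q)).Enters (nextFrame F R (copyV S v)) :=
  place_enters_place.2 (longFrame_enters (h.inUnit v) (h.root_inUnit Q) (h.root_inside Q v hv))

theorem nextFrame_adj (h : IsFrameModel P F R) (x y : P.next.V) (hxy : P.next.graph.Adj x y) :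
    (nextFrame F R x).Enters (nextFrame F R y) ∨ (nextFrame F R y).Enters (nextFrame F R x) := by
  induction x using next_cases with
  | base u =>
    induction y using next_cases with
    | base v => exact h.adj u v hxy
    | copy S v => exact absurd hxy next_adj_base_copy
    | apex S Q => exact absurd hxy next_adj_base_apex
  | copy S u =>
    induction y using next_cases with
    | base v => exact absurd hxy next_adj_copy_base
    | copy S' v =>
      obtain ⟨rfl, huv⟩ := next_adj_copy_copy.1 hxy
      exact (h.adj u v huv).imp place_enters_place.2 place_enters_place.2
    | apex S' Q =>
      obtain ⟨rfl, huv⟩ := next_adj_copy_apex.1 hxy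
      exact Or.inr (h.apex_enters_copy _ huv)
  | apex S Q =>
    induction y using next_cases with
    | base v => exact absurd hxy next_adj_apex_base
    | copy S' v =>
      obtain ⟨rfl, huv⟩ := next_adj_apex_copy.1 hxy
      exact Or.inl (h.apex_enters_copy _ huv)
    | apex S' Q' => exact absurd hxy next_adj_apex_apex

/-- The long frame stays in the strip to the right of the root of `Q`, which the frames outside `Q`
avoid. -/
theorem copy_apart_apex (h : IsFrameModel P F R) {S S' Q : P.stables} {v : P.V}
    (hv : ¬ (S' = S ∧ v ∈ Q.1)) :
    (nextFrame F R (copyV S v)).Apart (nextFrame F R (apexV S' Q)) := by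
  by_cases hS : S = S'
  · subst hS
    have hv : v ∉ Q.1 := fun hv' => hv ⟨rfl, hv'⟩
    exact place_apart_place.2 (h.avoids Q v hv).apart_longFrame
  · exact (h.root_ne hS (h.copy_inside S v) (h.apex_inside S' Q)).apart

theorem apex_apart_apex (h : IsFrameModel P F R) {S S' Q Q' : P.stables}
    (hne : apexV S Q ≠ apexV S' Q') :
    (nextFrame F R (apexV S Q)).Apart (nextFrame F R (apexV S' Q')) := by
  by_cases hS : S = S'
  · subst hS
    have hQ : Q ≠ Q' := fun e => hne (e ▸ rfl)
    exact (place_verticallyApart_place.2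
      ((h.root_apart Q Q' hQ).mono_within longFrame_within longFrame_within)).apart
  · exact (h.root_ne hS (h.apex_inside S Q) (h.apex_inside S' Q')).apart

theorem nextFrame_nonadj (h : IsFrameModel P F R) (x y : P.next.V) (hne : x ≠ y)
    (hxy : ¬ P.next.graph.Adj x y) : (nextFrame F R x).NestedOrApart (nextFrame F R y) := by
  induction x using next_cases with
  | base u =>
    induction y using next_cases with
    | base v => exact h.nonadj u v (fun e => hne (e ▸ rfl)) hxy
    | copy S v => exact h.nestedOrApart_of_inside (h.copy_inside S v) u
    | apex S Q => exact h.nestedOrApart_of_inside (h.apex_inside S Q) u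
  | copy S u =>
    induction y using next_cases with
    | base v => exact (h.nestedOrApart_of_inside (h.copy_inside S u) v).symm
    | copy S' v =>
      by_cases hS : S = S'
      · subst hS
        exact place_nestedOrApart_place.2
          (h.nonadj u v (fun e => hne (e ▸ rfl)) fun h' => hxy (next_adj_copy_copy.2 ⟨rfl, h'⟩))
      · exact Or.inr (Or.inr (h.root_ne hS (h.copy_inside S u) (h.copy_inside S' v)).apart)
    | apex S' Q => exact Or.inr (Or.inr (h.copy_apart_apex hxy))
  | apex S Q =>
    induction y using next_cases with
    | base v => exact (h.nestedOrApart_of_inside (h.apex_inside S Q) v).symm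
    | copy S' v => exact Or.inr (Or.inr (h.copy_apart_apex hxy).symm)
    | apex S' Q' => exact Or.inr (Or.inr (h.apex_apart_apex hne))

theorem next_triangle_free (h : IsFrameModel P F R) (x y z : P.next.V)
    (hxy : P.next.graph.Adj x y) (hyz : P.next.graph.Adj y z) : ¬ P.next.graph.Adj x z := by
  -- A triangle through a new vertex would need an edge within its neighbourhood, which is stable.
  have key : ∀ (Q : P.stables) {u v : P.V}, u ∈ Q.1 → v ∈ Q.1 → ¬ P.graph.Adj u v :=
    fun Q u v hu hv hadj => P.stable _ Q.2 hu hv hadj.ne hadj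
  intro hxz
  induction x using next_cases <;> induction y using next_cases <;>
    induction z using next_cases <;>
    simp only [next_adj_base_base, next_adj_base_copy, next_adj_copy_base, next_adj_base_apex,
      next_adj_apex_base, next_adj_apex_apex, next_adj_copy_copy, next_adj_apex_copy,
      next_adj_copy_apex] at hxy hyz hxz
  · exact h.triangle_free _ _ _ hxy hyz hxz
  · exact h.triangle_free _ _ _ hxy.2 hyz.2 hxz.2
  · exact key _ hxz.2 hyz.2 hxy.2
  · exact key _ hxy.2 hyz.2 hxz.2
  · exact key _ hxy.2 hxz.2 hyz.2

theorem not_inside_apex (h : IsFrameModel P F R) (S Q : P.stables) (x : P.next.V) :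
    ¬ (nextFrame F R x).Inside (nextFrame F R (apexV S Q)) := by
  induction x using next_cases with
  | base v => exact h.not_inside_of_inside (h.apex_inside S Q) v
  | copy S' v =>
    by_cases hv : S = S' ∧ v ∈ Q.1
    · obtain ⟨rfl, hv⟩ := hv
      exact (h.apex_enters_copy _ hv).not_inside'
    · exact (h.copy_apart_apex hv).not_inside
  | apex S' Q' =>
    by_cases hne : apexV S' Q' = apexV S Q
    · rw [hne]
      exact Inside.irrefl
    · exact (h.apex_apart_apex hne).not_inside

theorem inside_copy (h : IsFrameModel P F R) {S : P.stables} {v : P.V} {x : P.next.V}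
    (hx : (nextFrame F R x).Inside (nextFrame F R (copyV S v))) :
    ∃ u, x = copyV S u ∧ (F u).Inside (F v) := by
  induction x using next_cases with
  | base u => exact absurd hx (h.not_inside_of_inside (h.copy_inside S v) u)
  | copy S' u =>
    by_cases hS : S' = S
    · subst hS
      exact ⟨u, rfl, place_inside_place.1 hx⟩
    · exact absurd hx (h.root_ne hS (h.copy_inside S' u) (h.copy_inside S v)).apart.not_inside
  | apex S' Q =>
    by_cases hv : S' = S ∧ v ∈ Q.1
    · obtain ⟨rfl, hv⟩ := hv
      exact absurd hx (h.apex_enters_copy _ hv).not_inside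
    · exact absurd hx (h.copy_apart_apex hv).symm.not_inside

/-- For an edge of the first copy, a frame drawn in the root of `S` and inside both ends would put
both ends in the stable set `S`. An edge at a new vertex is harmless, as no frame is inside a long
frame. -/
theorem next_not_contained (h : IsFrameModel P F R) (x y z : P.next.V)
    (hxy : P.next.graph.Adj x y) (hx : (nextFrame F R z).Inside (nextFrame F R x)) :
    ¬ (nextFrame F R z).Inside (nextFrame F R y) := by
  intro hy
  induction x using next_cases with
  | base u =>
    induction y using next_cases with
    | base v =>
      have key : ∀ S : P.stables, u ∈ S.1 → v ∉ S.1 := fun S hu hv =>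
        P.stable _ S.2 hu hv (SimpleGraph.Adj.ne hxy) hxy
      induction z using next_cases with
      | base w => exact h.not_contained u v w hxy hx hy
      | copy S w =>
        exact key S ((h.inside_of_inside (h.copy_inside S w)).2 hx)
          ((h.inside_of_inside (h.copy_inside S w)).2 hy)
      | apex S Q =>
        exact key S ((h.inside_of_inside (h.apex_inside S Q)).2 hx)
          ((h.inside_of_inside (h.apex_inside S Q)).2 hy)
    | copy S v => exact next_adj_base_copy hxy
    | apex S Q => exact h.not_inside_apex S Q z hy
  | copy S u =>
    induction y using next_cases with
    | base v => exact next_adj_copy_base hxy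
    | copy S' v =>
      obtain ⟨rfl, huv⟩ := next_adj_copy_copy.1 hxy
      obtain ⟨w, rfl, hwu⟩ := h.inside_copy hx
      exact h.not_contained u v w huv hwu (place_inside_place.1 hy)
    | apex S' Q => exact h.not_inside_apex S' Q z hy
  | apex S Q => exact h.not_inside_apex S Q z hx

/-- The outer of the two nested frames is not a long frame. If it belongs to the first copy,
adjacency forces all three frames there; otherwise the inner one belongs to the same copy, and their
common neighbour lies in that copy or is a new vertex, which enters both. -/
theorem next_enters_both (h : IsFrameModel P F R) (x y z : P.next.V)
    (hxy : (nextFrame F R x).Inside (nextFrame F R y)) (hzx : P.next.graph.Adj z x)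
    (hzy : P.next.graph.Adj z y) :
    (nextFrame F R z).Enters (nextFrame F R x) ∧ (nextFrame F R z).Enters (nextFrame F R y) := by
  induction y using next_cases with
  | base v =>
    induction z using next_cases with
    | base w =>
      induction x using next_cases with
      | base u => exact h.enters_both u v w hxy hzx hzy
      | copy S u => exact absurd hzx next_adj_base_copy
      | apex S Q => exact absurd hzx next_adj_base_apex
    | copy S w => exact absurd hzy next_adj_copy_base
    | apex S Q => exact absurd hzy next_adj_apex_base
  | copy S v =>
    obtain ⟨u, rfl, huv⟩ := h.inside_copy hxy
    induction z using next_cases with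
    | base w => exact absurd hzy next_adj_base_copy
    | copy S' w =>
      obtain ⟨rfl, hwu⟩ := next_adj_copy_copy.1 hzx
      exact (h.enters_both u v w huv hwu (next_adj_copy_copy.1 hzy).2).imp
        place_enters_place.2 place_enters_place.2
    | apex S' Q =>
      obtain ⟨rfl, hu⟩ := next_adj_apex_copy.1 hzx
      exact ⟨h.apex_enters_copy _ hu, h.apex_enters_copy _ (next_adj_apex_copy.1 hzy).2⟩
  | apex S Q => exact absurd hxy (h.not_inside_apex S Q x)

theorem next (h : IsFrameModel P F R) : ∃ R', IsFrameModel P.next (nextFrame F R) R' := by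
  -- Any section of `nextStable` will do: distinct triples have vertically disjoint rectangles, and
  -- a section is injective.
  have hinv := Function.rightInverse_surjInv (nextStable_surjective (P := P))
  refine ⟨fun X => nextRoot R (Function.surjInv nextStable_surjective X), h.nextFrame_inUnit,
    fun X => (h.root_inUnit _).of_inside (h.nextRoot_inside _ _ _),
    fun X x hx => h.nextRoot_inside_nextFrame _ _ ((hinv X).symm ▸ hx),
    fun X x hx => h.nextFrame_avoids_nextRoot _ _ ((hinv X).symm ▸ hx),
    fun X X' hne => h.nextRoot_apart fun e => hne (hinv.injective e), h.nextFrame_adj,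
    h.nextFrame_nonadj, h.next_triangle_free, h.next_not_contained, h.next_enters_both⟩

theorem isStrict_range (h : IsFrameModel P F R) : IsStrict (Set.range F) :=
  Frame.isStrict_range h.adj h.nonadj h.triangle_free h.not_contained h.enters_both

end IsFrameModel

/-- The graphs of the Burling sequence are intersection graphs of strict families of frames. -/
theorem exists_isFrameModel_burlingSeq : ∀ k, ∃ F R, IsFrameModel (burlingSeq k) F R
  | 0 => by
    let A : Frame := ⟨1 / 5, 4 / 5, 1 / 5, 4 / 5, by norm_num, by norm_num⟩
    let B : Frame := ⟨2 / 5, 3 / 5, 2 / 5, 3 / 5, by norm_num, by norm_num⟩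
    have hV : ∀ u v : (burlingSeq 0).V, u = v := fun _ _ => rfl
    have hadj : ∀ u v : (burlingSeq 0).V, ¬ (burlingSeq 0).graph.Adj u v := fun u v h => h
    have hst : ∀ S : (burlingSeq 0).stables, S.1 = Set.univ := fun S => S.2
    refine ⟨fun _ => A, fun _ => B, ?_, ?_, ?_, ?_, ?_, ?_, ?_, ?_, ?_, ?_⟩
    · intro
      constructor <;> norm_num [A]
    · intro
      constructor <;> norm_num [B]
    · intro S v _
      rw [Frame.inside_iff]
      norm_num [A, B]
    · intro S v hv
      exact absurd (hst S ▸ Set.mem_univ v) hv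
    · intro S S' hne
      exact absurd (Subtype.ext ((hst S).trans (hst S').symm)) hne
    · exact fun u v h => absurd h (hadj u v)
    · exact fun u v h => absurd (hV u v) h
    · exact fun u v w h => absurd h (hadj u v)
    · exact fun u v w h => absurd h (hadj u v)
    · exact fun u v w _ h => absurd h (hadj w u)
  | k + 1 => by
    obtain ⟨F, R, h⟩ := exists_isFrameModel_burlingSeq k
    obtain ⟨R', h'⟩ := h.next
    exact ⟨_, R', h'⟩

/-! ### Finiteness and the two inclusions -/

theorem StablePair.finite_next (P : StablePair) [Finite P.V] : Finite P.next.V :=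
  Finite.of_surjective
    (Sum.elim baseV (Sum.elim (fun p : P.stables × P.V => copyV p.1 p.2)
      fun p : P.stables × P.stables => apexV p.1 p.2)) fun x => by
    induction x using next_cases with
    | base v => exact ⟨Sum.inl v, rfl⟩
    | copy S v => exact ⟨Sum.inr (Sum.inl (S, v)), rfl⟩
    | apex S Q => exact ⟨Sum.inr (Sum.inr (S, Q)), rfl⟩

theorem finite_burlingSeq : ∀ k, Finite (burlingSeq k).V
  | 0 => inferInstanceAs (Finite Unit)
  | k + 1 => by
    have := finite_burlingSeq k
    exact (burlingSeq k).finite_next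

theorem IsStrictBoxGraph.isBurlingGraph {V : Type*} {G : SimpleGraph V}
    (h : IsStrictBoxGraph G) : IsBurlingGraph G := by
  obtain ⟨𝓑, hfin, ⟨S, I, hS, hI, rfl⟩, ⟨e⟩⟩ := h
  -- The vertices are boxes, so the frames are finite in number and match the vertices only because
  -- a nonempty box determines its frame.
  have hinj : Set.InjOn (fun A : Frame => A.box (I A)) S := fun A hA B hB hAB =>
    eq_of_box_eq (hI.nonempty A hA) (hI.nonempty B hB) hAB
  obtain ⟨k, φ, hφ⟩ := hS.exists_isBranchEmbedding (hfin.of_finite_image hinj)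
  choose f hfS hf using fun v => (e v).2
  have hne : ∀ u v, u ≠ v → f u ≠ f v := fun u v huv hfe =>
    huv (e.injective (Subtype.ext (by rw [← hf u, ← hf v, hfe])))
  refine ⟨k, ⟨⟨⟨fun v => φ (f v), fun u v huv => ?_⟩, fun {u v} => ?_⟩⟩⟩
  · by_contra hn
    exact hne u v hn (hφ.injOn (hfS u) (hfS v) huv)
  · change (burlingSeq k).graph.Adj (φ (f u)) (φ (f v)) ↔ G.Adj u v
    rcases eq_or_ne u v with rfl | huv
    · simp
    rw [hφ.adj _ (hfS u) _ (hfS v), ← hS.meets_iff (hfS u) (hfS v) (hne u v huv),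
      ← hI.box_inter_nonempty_iff hS.toIsRestricted (hfS u) (hfS v), ← e.map_adj_iff]
    have h1 : (f u).box (I (f u)) = (e u).1 := hf u
    have h2 : (f v).box (I (f v)) = (e v).1 := hf v
    rw [h1, h2]
    exact ⟨fun h => ⟨fun h' => huv (e.injective h'), h⟩, fun h => h.2⟩

theorem IsBurlingGraph.isStrictBoxGraph {V : Type*} {G : SimpleGraph V}
    (h : IsBurlingGraph G) : IsStrictBoxGraph G := by
  obtain ⟨k, ⟨e⟩⟩ := h
  obtain ⟨F, R, hF⟩ := exists_isFrameModel_burlingSeq k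
  have := finite_burlingSeq k
  have : Finite V := Finite.of_injective e e.injective
  let f : V → Frame := fun v => F (e v)
  have hS : IsStrict (Set.range f) :=
    hF.isStrict_range.mono (Set.range_comp_subset_range e F)
  have hfin : (Set.range f).Finite := Set.finite_range f
  obtain ⟨I, hI, -⟩ := hS.exists_isCompatible hfin
  have hadj : ∀ u v, G.Adj u v ↔ u ≠ v ∧ (f u).Meets (f v) := by
    intro u v
    rw [← e.map_adj_iff]
    constructor
    · intro h
      exact ⟨fun huv => h.ne (huv ▸ rfl), (hF.adj _ _ h).elim Enters.meets fun h => h.meets.symm⟩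
    · rintro ⟨huv, hm⟩
      by_contra hn
      exact (hF.nonadj _ _ (fun h => huv (e.injective h)) hn).not_meets hm
  -- Equal frames meet, so their distinct vertices would be adjacent, and a frame would enter
  -- itself.
  have hf : ∀ u v, f u = f v → u = v := by
    intro u v huv
    by_contra hn
    have hm : (f u).Meets (f v) := by
      rw [huv, Meets, Set.inter_self]
      exact nonempty_points _
    have := (e.map_adj_iff.2 ((hadj u v).2 ⟨hn, hm⟩))
    have huv : F (e u) = F (e v) := huv
    have := hF.adj _ _ this
    rw [huv] at this
    exact this.elim Enters.irrefl Enters.irrefl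
  let g : V → ((fun A : Frame => A.box (I A)) '' Set.range f) := fun v =>
    ⟨(f v).box (I (f v)), f v, ⟨v, rfl⟩, rfl⟩
  have hg : Function.Bijective g := by
    refine ⟨fun u v huv => hf u v (eq_of_box_eq (hI.nonempty _ ⟨u, rfl⟩) (hI.nonempty _ ⟨v, rfl⟩)
      (congrArg Subtype.val huv)), ?_⟩
    rintro ⟨_, _, ⟨v, rfl⟩, rfl⟩
    exact ⟨v, rfl⟩
  refine ⟨_, hfin.image _, ⟨_, I, hS, hI, rfl⟩, ⟨⟨Equiv.ofBijective g hg, fun {u v} => ?_⟩⟩⟩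
  rw [hadj, ← hI.box_inter_nonempty_iff hS.toIsRestricted ⟨u, rfl⟩ ⟨v, rfl⟩]
  exact and_congr_left fun _ => hg.injective.ne_iff

theorem theorem6p15 :
    (∀ (V : Type*) (G : SimpleGraph V), IsStrictBoxGraph G ↔ IsBurlingGraph G) ∧
    (∀ S : Set Frame, S.Finite → Frame.IsStrict S →
      ∃ I : Frame → Set ℝ, Frame.IsCompatible S I ∧
        ∀ A ∈ S, ∃ a b : ℝ, a < b ∧ I A = Set.Icc a b) ∧
    (∀ (S : Set Frame) (I : Frame → Set ℝ), Frame.IsStrict S → Frame.IsCompatible S I →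
      ∀ A ∈ S, ∀ B ∈ S,
        ((A.box (I A) ∩ B.box (I B)).Nonempty ↔ (A.points ∩ B.points).Nonempty)) :=
  ⟨fun _ _ => ⟨IsStrictBoxGraph.isBurlingGraph, IsBurlingGraph.isStrictBoxGraph⟩,
    fun _ hfin hS => hS.exists_isCompatible hfin,
    fun _ _ hS hI _ hA _ hB => hI.box_inter_nonempty_iff hS.toIsRestricted hA hB⟩
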